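/- Let $\tau\neq 0$ and let $\mathbb H_3(\tau)$ be $\mathbb R^3$ with the Lorentzian metric $g_\tau=dx^2+dy^2-(dz-\tau(y\,dx-x\,dy))^2$ and the orthonormal frame $E_1=\partial_x+\tau y\,\partial_z$, $E_2=\partial_y-\tau x\,\partial_z$, $E_3=\partial_z$; its cross product is $U\wedge V=(u_2v_3-u_3v_2)E_1-(u_1v_3-u_3v_1)E_2-(u_1v_2-u_2v_1)E_3$ for $U=\sum u_iE_i$, $V=\sum v_iE_i$. Let $\mathcal M$ be a smooth spacelike surface immersed in $\mathbb H_3(\tau)$, with a smooth unit normal $N$, $g_\tau(N,N)=-1$, and suppose that $\mathcal M$ is a helix surface with constant hyperbolic angle $\vartheta>0$, that is, $-g_\tau(N,E_3)=\cosh\vartheta$ on $\mathcal M$. Put $T=E_3-\cosh\vartheta\,N$ (the tangential part of $E_3$) and $JT=N\wedge T$. (1) Around every point of $\mathcal M$ there are smooth local coordinates $(u,v)$, with convex range, such that $$\partial_u=T,\qquad \partial_v=\frac{\sin(\eta(v)-2\tau\cosh^2\vartheta\,u)}{\cosh\vartheta}\,T+\cos(\eta(v)-2\tau\cosh^2\vartheta\,u)\,JT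 \qquad (*)$$ for some smooth function $\eta$. (2) For every system of smooth local coordinates $(u,v)$ with convex range that satisfies $(*)$ for some smooth $\eta$, there are a constant $c\in\mathbb R$ and smooth functions $f_1,f_2,f_3$ of $v$ such that, with $\varphi(u)=-2\tau\cosh^2\vartheta\,u+c$, the position vector of $\mathcal M$ at the point with coordinates $(u,v)$ is $F(\varphi(u),v)$, where $$F(u,v)=\Big(\tfrac{\tanh\vartheta}{2\tau}\sin u+f_1(v),\ -\tfrac{\tanh\vartheta}{2\tau}\cos u+f_2(v),\ \tfrac{\tanh^2\vartheta}{4\tau}\,u+\tfrac{\tanh\vartheta}{2}\,[f_1(v)\cos u+f_2(v)\sin u]+f_3(v)\Big)$$ and $$f_1'(v)^2+f_2'(v)^2=\sinh^2\vartheta,\qquad f_3'(v)=\tau\,(f_2(v)f_1'(v)-f_1(v)f_2'(v)).$$ In other words, after the change of variable $\varphi(u)\mapsto u$, the surface is locally parametrized by $F(u,v)$. -/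

import Mathlib

open scoped Manifold ContDiff

noncomputable section

namespace LorentzHeisenberg

/-- The underlying space `ℝ³`, with coordinates `(x, y, z) = (p 0, p 1, p 2)`; tangent vectors at a
point of `ℝ³` are given by their components with respect to `∂/∂x, ∂/∂y, ∂/∂z`. -/
abbrev R3 : Type := EuclideanSpace ℝ (Fin 3)

/-- The coordinate plane, with coordinates `(u, v) = (x 0, x 1)`. -/
abbrev R2 : Type := EuclideanSpace ℝ (Fin 2)

/-- The value at the vector `w`, tangent at `p`, of the one-form `dz - τ (y dx - x dy)`. -/
def vert (τ : ℝ) (p w : R3) : ℝ := w 2 - τ * (p 1 * w 0 - p 0 * w 1)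

/-- The Lorentzian metric `g_τ = dx² + dy² - (dz - τ (y dx - x dy))²` at the point `p`. -/
def metric (τ : ℝ) (p w w' : R3) : ℝ := w 0 * w' 0 + w 1 * w' 1 - vert τ p w * vert τ p w'

/-- `E₁ = ∂/∂x + τ y ∂/∂z`. -/
def E1 (τ : ℝ) (p : R3) : R3 := !₂[1, 0, τ * p 1]

/-- `E₂ = ∂/∂y - τ x ∂/∂z`. -/
def E2 (τ : ℝ) (p : R3) : R3 := !₂[0, 1, -(τ * p 0)]

/-- `E₃ = ∂/∂z`. -/
def E3 : R3 := !₂[0, 0, 1]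

/-- The cross product of `g_τ` at `p`: the components of a tangent vector `w` with respect to
`E₁, E₂, E₃` are `w 0`, `w 1` and `vert τ p w`. -/
def cross (τ : ℝ) (p w w' : R3) : R3 :=
  (w 1 * vert τ p w' - vert τ p w * w' 1) • E1 τ p
    - (w 0 * vert τ p w' - vert τ p w * w' 0) • E2 τ p
    - (w 0 * w' 1 - w 1 * w' 0) • E3

section Surface

variable {M : Type*} [TopologicalSpace M] [ChartedSpace R2 M]

/-- `X : M → (ℝ³, g_τ)` is a smooth immersion and the metric it induces on `M` is Riemannian. -/
structure IsSpacelikeImmersion (τ : ℝ) (X : M → R3) : Prop where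
  smooth : ContMDiff (𝓡 2) (𝓡 3) ∞ X
  immersion : ∀ p, Function.Injective (mfderiv (𝓡 2) (𝓡 3) X p)
  spacelike : ∀ (p : M) (w : TangentSpace (𝓡 2) p), w ≠ 0 →
    0 < metric τ (X p) (mfderiv (𝓡 2) (𝓡 3) X p w) (mfderiv (𝓡 2) (𝓡 3) X p w)

/-- `N` is a smooth unit normal vector field along the immersion `X`, with `g_τ(N, N) = -1`
(as it must be for a spacelike surface); `N p` is a tangent vector of `ℝ³` at `X p`. -/
structure IsUnitNormal (τ : ℝ) (X N : M → R3) : Prop where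
  smooth : ContMDiff (𝓡 2) (𝓡 3) ∞ N
  normal : ∀ (p : M) (w : TangentSpace (𝓡 2) p),
    metric τ (X p) (N p) (mfderiv (𝓡 2) (𝓡 3) X p w) = 0
  unit : ∀ p, metric τ (X p) (N p) (N p) = -1

/-- The angle function `ν = g_τ(N, N) g_τ(N, E₃)`. -/
def angleFn (τ : ℝ) (X N : M → R3) (p : M) : ℝ :=
  metric τ (X p) (N p) (N p) * metric τ (X p) (N p) E3

/-- The tangential part `T = E₃ - ν N` of `E₃` (as a vector of `ℝ³`, at `X p`). -/
def tangentPart (τ : ℝ) (X N : M → R3) (p : M) : R3 := E3 - angleFn τ X N p • N p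

/-- The rotated field `JT = N ∧ T`. -/
def rotTangentPart (τ : ℝ) (X N : M → R3) (p : M) : R3 :=
  cross τ (X p) (N p) (tangentPart τ X N p)

/-- `(X, N)` is a helix spacelike surface with constant hyperbolic angle `ϑ`: the unit normal `N`
is oriented so that the angle function is `cosh ϑ`. -/
structure IsHelixSpacelike (τ ϑ : ℝ) (X N : M → R3) : Prop where
  spacelike : IsSpacelikeImmersion τ X
  unitNormal : IsUnitNormal τ X N
  angle : ∀ p, angleFn τ X N p = Real.cosh ϑ

/-- The `v`-projection of the domain of the coordinates `e`. -/
def vRange (e : OpenPartialHomeomorph M R2) : Set ℝ := (fun x : R2 => x 1) '' e.target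

/-- The smooth local coordinates `e = (u, v)` on `M`, with convex range, are adapted to the surface:
`∂_u = T` and `∂_v = a T + b JT`, where
`a = sin (η(v) - 2 τ cosh²ϑ u) / cosh ϑ` and `b = cos (η(v) - 2 τ cosh²ϑ u)`
for a smooth function `η`. -/
structure IsAdapted (τ ϑ : ℝ) (X N : M → R3) (e : OpenPartialHomeomorph M R2) (η : ℝ → ℝ) :
    Prop where
  mem_atlas : e ∈ IsManifold.maximalAtlas (𝓡 2) ∞ M
  convex : Convex ℝ e.target
  smooth : ContDiffOn ℝ ∞ η (vRange e)
  du : ∀ x ∈ e.target,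
    fderiv ℝ (fun y => X (e.symm y)) x (EuclideanSpace.single 0 1)
      = tangentPart τ X N (e.symm x)
  dv : ∀ x ∈ e.target,
    fderiv ℝ (fun y => X (e.symm y)) x (EuclideanSpace.single 1 1)
      = (Real.sin (η (x 1) - 2 * τ * Real.cosh ϑ ^ 2 * x 0) / Real.cosh ϑ)
            • tangentPart τ X N (e.symm x)
        + Real.cos (η (x 1) - 2 * τ * Real.cosh ϑ ^ 2 * x 0)
            • rotTangentPart τ X N (e.symm x)

end Surface

/-- The parametrization built from three functions `f₁, f₂, f₃` of `v`. -/
def helixParam (τ ϑ : ℝ) (f₁ f₂ f₃ : ℝ → ℝ) (u v : ℝ) : R3 :=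
  !₂[Real.tanh ϑ / (2 * τ) * Real.sin u + f₁ v,
     -(Real.tanh ϑ / (2 * τ)) * Real.cos u + f₂ v,
     Real.tanh ϑ ^ 2 / (4 * τ) * u
       + Real.tanh ϑ / 2 * (f₁ v * Real.cos u + f₂ v * Real.sin u) + f₃ v]

end LorentzHeisenberg

end

open LorentzHeisenberg

namespace LorentzHeisenberg

open Set Filter Topology

/-! Write the horizontal part of `N` as `sinh ϑ (cos α, sin α)`. Its vertical component being `cosh
ϑ`, normality is an equation of one-forms on the surface, `N₀ dx + N₁ dy = cosh ϑ (dz - τ (y dx - x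
dy))`. Its exterior derivative is `dN₀ ∧ dx + dN₁ ∧ dy = 2 τ cosh ϑ dx ∧ dy` (`structure_eq`), which
drives both halves.

Existence of coordinates: put `F₁ = x - tanh ϑ/(2τ) sin α` and `F₂ = y + tanh ϑ/(2τ) cos α` (the
directrix). In these terms the structure equation says `dF₁ ∧ dF₂ = 0`, so `(F₁, F₂)` traces a plane
curve. As `dα` is independent of `dF₁` or of `dF₂` (`exists_independent`), a multiple of `α` and one
of the `Fᵢ` form a chart, in which the directrix depends on the second coordinate alone
(`directrix_deriv`). Giving the curve constant speed `sinh ϑ` makes the chart adapted; `η` is the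
angle of its velocity.

Parametrization: in adapted coordinates the structure equation determines the `u`-derivative of the
horizontal part of `N`, and equality of mixed derivatives of the position forces its `v`-derivative
to vanish (`normal_deriv_of_adapted`). Hence `α = -2 τ cosh²ϑ u + c` (`exists_normal_eq`). Solving
the claimed formula for `f₁, f₂, f₃` then gives functions with zero `u`-derivative. -/

/-! ### Calculus preliminaries: coordinates, second derivatives, angle functions, primitives. -/

/-- The first coordinate direction of the plane. -/
noncomputable abbrev e₀ : R2 := EuclideanSpace.single 0 1

/-- The second coordinate direction of the plane. -/
noncomputable abbrev e₁ : R2 := EuclideanSpace.single 1 1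

lemma R2.eq_smul_add_smul (w : R2) : w = w 0 • e₀ + w 1 • e₁ := by
  ext i; fin_cases i <;> simp

lemma R3.ext_iff' {a b : R3} : a = b ↔ a 0 = b 0 ∧ a 1 = b 1 ∧ a 2 = b 2 := by
  constructor
  · rintro rfl; simp
  · rintro ⟨h0, h1, h2⟩; ext i; fin_cases i <;> assumption

lemma map_R2 {F : Type*} [NormedAddCommGroup F] [NormedSpace ℝ F] (L : R2 →L[ℝ] F) (w : R2) :
    L w = w 0 • L e₀ + w 1 • L e₁ := by
  conv_lhs => rw [R2.eq_smul_add_smul w]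
  simp only [map_add, map_smul]

/-- The `i`-th coordinate as a continuous linear form. -/
noncomputable abbrev coord {n : ℕ} (i : Fin n) : EuclideanSpace ℝ (Fin n) →L[ℝ] ℝ := EuclideanSpace.proj i

lemma contDiffOn_coord {E : Type*} [NormedAddCommGroup E] [NormedSpace ℝ E] {m : ℕ} {s : Set E}
    {F : E → EuclideanSpace ℝ (Fin m)} (hF : ContDiffOn ℝ ∞ F s) (i : Fin m) :
    ContDiffOn ℝ ∞ (fun y => F y i) s :=
  (coord i).contDiff.comp_contDiffOn hF

lemma fderiv_coord {E : Type*} [NormedAddCommGroup E] [NormedSpace ℝ E] {m : ℕ}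
    {F : E → EuclideanSpace ℝ (Fin m)} {x : E} (hF : DifferentiableAt ℝ F x) (i : Fin m) (w : E) :
    fderiv ℝ (fun y => F y i) x w = fderiv ℝ F x w i := by
  have := ((coord i).hasFDerivAt.comp x hF.hasFDerivAt).fderiv
  have h2 : (fun y => F y i) = (coord i) ∘ F := rfl
  rw [h2, this]; rfl

lemma ContDiffOn.diffAt {E F : Type*} [NormedAddCommGroup E] [NormedSpace ℝ E]
    [NormedAddCommGroup F] [NormedSpace ℝ F] {s : Set E} {f : E → F} (hf : ContDiffOn ℝ ∞ f s)
    (hs : IsOpen s) {x : E} (hx : x ∈ s) : DifferentiableAt ℝ f x :=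
  (hf.contDiffAt (hs.mem_nhds hx)).differentiableAt (by simp)

/-- The derivative of a directional derivative is the second derivative. -/
lemma fderiv_fderiv_apply {E F : Type*} [NormedAddCommGroup E] [NormedSpace ℝ E]
    [NormedAddCommGroup F] [NormedSpace ℝ F] {s : Set E} {f : E → F} (hf : ContDiffOn ℝ ∞ f s)
    (hs : IsOpen s) {x : E} (hx : x ∈ s) (w : E) :
    HasFDerivAt (fun y => fderiv ℝ f y w) ((fderiv ℝ (fderiv ℝ f) x).flip w) x := by
  have h1 : ContDiffAt ℝ 1 (fderiv ℝ f) x :=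
    (hf.contDiffAt (hs.mem_nhds hx)).fderiv_right (by norm_num; exact WithTop.coe_le_coe.2 le_top)
  have h2 := (h1.differentiableAt (by simp)).hasFDerivAt
  have h3 := h2.clm_apply (hasFDerivAt_const w x)
  convert h3 using 1
  ext v; simp

lemma fderiv_fderiv_symm {E F : Type*} [NormedAddCommGroup E] [NormedSpace ℝ E]
    [NormedAddCommGroup F] [NormedSpace ℝ F] {s : Set E} {f : E → F} (hf : ContDiffOn ℝ ∞ f s)
    (hs : IsOpen s) {x : E} (hx : x ∈ s) (v w : E) :
    fderiv ℝ (fderiv ℝ f) x v w = fderiv ℝ (fderiv ℝ f) x w v :=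
  (hf.contDiffAt (hs.mem_nhds hx)).isSymmSndFDerivAt
    (by simp; exact WithTop.coe_le_coe.2 le_top) v w

lemma exists_polar {a b R : ℝ} (hR : 0 < R) (h : a ^ 2 + b ^ 2 = R ^ 2) :
    ∃ c : ℝ, a = R * Real.cos c ∧ b = R * Real.sin c := by
  have hn : ‖(⟨a, b⟩ : ℂ)‖ = R := by
    rw [Complex.norm_eq_sqrt_sq_add_sq, h, Real.sqrt_sq hR.le]
  exact ⟨Complex.arg ⟨a, b⟩, by rw [← hn, Complex.norm_mul_cos_arg],
    by rw [← hn, Complex.norm_mul_sin_arg]⟩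

/-- A pair of smooth functions on a circle has locally a smooth angle function. -/
lemma exists_angle {E : Type*} [NormedAddCommGroup E] [NormedSpace ℝ E] {U : Set E}
    (hU : IsOpen U) {a b : E → ℝ} (ha : ContDiffOn ℝ ∞ a U) (hb : ContDiffOn ℝ ∞ b U) {R : ℝ}
    (hR : 0 < R) (hab : ∀ x ∈ U, a x ^ 2 + b x ^ 2 = R ^ 2) {x₀ : E} (hx₀ : x₀ ∈ U) :
    ∃ (V : Set E) (α : E → ℝ), IsOpen V ∧ x₀ ∈ V ∧ V ⊆ U ∧ ContDiffOn ℝ ∞ α V ∧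
      ∀ x ∈ V, a x = R * Real.cos (α x) ∧ b x = R * Real.sin (α x) := by
  obtain ⟨c, hc1, hc2⟩ := exists_polar hR (hab x₀ hx₀)
  have hsc := Real.sin_sq_add_cos_sq c
  -- Rotating by `-c` moves the value at `x₀` to the positive axis; where `p > 0`, `arctan (q / p)`
  -- is a smooth angle of the rotated pair.
  let p : E → ℝ := fun x => Real.cos c * a x + Real.sin c * b x
  let q : E → ℝ := fun x => -Real.sin c * a x + Real.cos c * b x
  have hp : ContDiffOn ℝ ∞ p U := (contDiffOn_const.mul ha).add (contDiffOn_const.mul hb)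
  have hq : ContDiffOn ℝ ∞ q U := (contDiffOn_const.mul ha).add (contDiffOn_const.mul hb)
  have hV : IsOpen (U ∩ p ⁻¹' Ioi 0) := hp.continuousOn.isOpen_inter_preimage hU isOpen_Ioi
  refine ⟨U ∩ p ⁻¹' Ioi 0, fun x => c + Real.arctan (q x / p x), hV, ⟨hx₀, ?_⟩, inter_subset_left,
    ?_, ?_⟩
  · have : p x₀ = R := by simp only [p, hc1, hc2]; linear_combination R * hsc
    simpa [this] using hR
  · refine contDiffOn_const.add (Real.contDiff_arctan.comp_contDiffOn ?_)
    exact (hq.mono inter_subset_left).div (hp.mono inter_subset_left) fun x hx => hx.2.ne'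
  · rintro x ⟨hx, hpx⟩
    have hpx : 0 < p x := hpx
    have hpq : p x ^ 2 + q x ^ 2 = R ^ 2 := by
      simp only [p, q]; linear_combination hab x hx + (a x ^ 2 + b x ^ 2) * hsc
    have hs : √(1 + (q x / p x) ^ 2) = R / p x := by
      rw [Real.sqrt_eq_iff_mul_self_eq (by positivity) (by positivity)]
      field_simp; linarith
    have hcos : R * Real.cos (Real.arctan (q x / p x)) = p x := by
      rw [Real.cos_arctan, hs]; field_simp
    have hsin : R * Real.sin (Real.arctan (q x / p x)) = q x := by
      rw [Real.sin_arctan, hs]; field_simp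
    rw [Real.cos_add, Real.sin_add]
    constructor
    · have : a x = Real.cos c * p x - Real.sin c * q x := by
        simp only [p, q]; linear_combination (-a x) * hsc
      linear_combination this - Real.cos c * hcos + Real.sin c * hsin
    · have : b x = Real.sin c * p x + Real.cos c * q x := by
        simp only [p, q]; linear_combination (-b x) * hsc
      linear_combination this - Real.sin c * hcos - Real.cos c * hsin

lemma isOpen_image_coord_one {U : Set R2} (hU : IsOpen U) : IsOpen ((fun x : R2 => x 1) '' U) := by
  have h : Function.Surjective (coord (n := 2) 1) := fun v => ⟨v • e₁, by simp⟩
  exact (coord (n := 2) 1).isOpenMap h U hU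

/-- On a convex open subset of the plane, a function whose first partial derivative vanishes is a
function of the second coordinate. -/
lemma exists_eq_comp_coord_one {U : Set R2} (hU : IsOpen U) (hc : Convex ℝ U) {k : R2 → ℝ}
    (hk : ContDiffOn ℝ ∞ k U) (h0 : ∀ x ∈ U, fderiv ℝ k x e₀ = 0) :
    ∃ f : ℝ → ℝ, ContDiffOn ℝ ∞ f ((fun x : R2 => x 1) '' U) ∧ (∀ x ∈ U, k x = f (x 1)) ∧
      ∀ x ∈ U, HasDerivAt f (fderiv ℝ k x e₁) (x 1) := by
  -- Convexity makes each slice with constant second coordinate a segment, along which `k` has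
  -- derivative zero.
  have key : ∀ x ∈ U, ∀ y ∈ U, x 1 = y 1 → k y = k x := by
    intro x hx y hy hxy
    have hmem : ∀ t ∈ Icc (0 : ℝ) 1, x + t • (y - x) ∈ U := fun t ht =>
      hc.add_smul_sub_mem hx hy ht
    have hd : ∀ t ∈ Icc (0 : ℝ) 1, HasDerivAt (fun t : ℝ => k (x + t • (y - x))) 0 t := by
      intro t ht
      have h1 : HasDerivAt (fun t : ℝ => x + t • (y - x)) (y - x) t := by
        simpa using ((hasDerivAt_id t).smul_const (y - x)).const_add x
      have h2 := (ContDiffOn.diffAt hk hU (hmem t ht)).hasFDerivAt.comp_hasDerivAt t h1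
      have h3 : fderiv ℝ k (x + t • (y - x)) (y - x) = 0 := by
        rw [map_R2, h0 _ (hmem t ht)]
        simp [hxy]
      rwa [h3] at h2
    have := constant_of_has_deriv_right_zero
      (fun t ht => (hd t ht).continuousAt.continuousWithinAt)
      (fun t ht => (hd t (Ico_subset_Icc_self ht)).hasDerivWithinAt) 1 (by simp)
    simpa using this
  have hchoose : ∀ v : ℝ, ∃ r : ℝ, ∀ x ∈ U, x 1 = v → k x = r := by
    intro v
    by_cases h : ∃ x ∈ U, x 1 = v
    · obtain ⟨x, hx, rfl⟩ := h
      exact ⟨k x, fun y hy h => key x hx y hy h.symm⟩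
    -- Off the projection of `U` the value is arbitrary.
    · exact ⟨0, fun x hx hv => absurd ⟨x, hx, hv⟩ h⟩
  choose f hf using hchoose
  have hline : ∀ x : R2, ContDiff ℝ ∞ (fun v : ℝ => x + (v - x 1) • e₁) := fun x => by fun_prop
  have hev : ∀ x ∈ U, f =ᶠ[𝓝 (x 1)] fun v => k (x + (v - x 1) • e₁) := by
    intro x hx
    have : (fun v : ℝ => x + (v - x 1) • e₁) ⁻¹' U ∈ 𝓝 (x 1) :=
      (hline x).continuous.continuousAt.preimage_mem_nhds (by simpa using hU.mem_nhds hx)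
    filter_upwards [this] with v hv
    exact (hf v _ hv (by simp)).symm
  refine ⟨f, ?_, fun x hx => hf _ x hx rfl, ?_⟩
  · rintro _ ⟨x, hx, rfl⟩
    refine ContDiffAt.contDiffWithinAt (ContDiffAt.congr_of_eventuallyEq ?_ (hev x hx))
    refine ContDiffAt.comp (x 1) ?_ (hline x).contDiffAt
    simpa using hk.contDiffAt (hU.mem_nhds hx)
  · intro x hx
    refine HasDerivAt.congr_of_eventuallyEq ?_ (hev x hx)
    have h1 : HasDerivAt (fun v : ℝ => x + (v - x 1) • e₁) e₁ (x 1) := by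
      simpa using (((hasDerivAt_id (x 1)).sub_const (x 1)).smul_const e₁).const_add x
    have h2 : HasFDerivAt k (fderiv ℝ k x) (x + (x 1 - x 1) • e₁) := by
      simpa using (ContDiffOn.diffAt hk hU hx).hasFDerivAt
    exact h2.comp_hasDerivAt (x 1) h1

/-- A smooth function on an open interval has a smooth primitive. -/
lemma exists_primitive {I : Set ℝ} (hI : IsOpen I) (hc : Convex ℝ I) {g : ℝ → ℝ}
    (hg : ContDiffOn ℝ ∞ g I) :
    ∃ G : ℝ → ℝ, ContDiffOn ℝ ∞ G I ∧ ∀ v ∈ I, HasDerivAt G (g v) v := by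
  rcases I.eq_empty_or_nonempty with rfl | ⟨v₀, hv₀⟩
  · exact ⟨0, by simp [contDiffOn_empty], by simp⟩
  have hd : ∀ v ∈ I, HasDerivAt (fun v => ∫ t in v₀..v, g t) (g v) v := by
    intro v hv
    refine intervalIntegral.integral_hasDerivAt_right ?_ ?_
      (hg.continuousOn.continuousAt (hI.mem_nhds hv))
    · refine ContinuousOn.intervalIntegrable (hg.continuousOn.mono ?_)
      rw [← segment_eq_uIcc]; exact hc.segment_subset hv₀ hv
    · exact hg.continuousOn.stronglyMeasurableAtFilter hI v hv
  refine ⟨_, ?_, hd⟩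
  rw [contDiffOn_infty_iff_deriv_of_isOpen hI]
  exact ⟨fun v hv => (hd v hv).differentiableAt.differentiableWithinAt,
    hg.congr fun v hv => (hd v hv).deriv⟩

/-! ### First-order geometry of a helix surface in a parameter domain. -/

/-- A helix spacelike surface parametrized by an open subset of the plane. -/
structure LocalHelix (τ ϑ : ℝ) (U : Set R2) (Y N : R2 → R3) : Prop where
  isOpen : IsOpen U
  smooth : ContDiffOn ℝ ∞ Y U
  smooth_normal : ContDiffOn ℝ ∞ N U
  injective : ∀ x ∈ U, Function.Injective (fderiv ℝ Y x)
  normal : ∀ x ∈ U, ∀ w, metric τ (Y x) (N x) (fderiv ℝ Y x w) = 0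
  horizontal : ∀ x ∈ U, N x 0 ^ 2 + N x 1 ^ 2 = Real.sinh ϑ ^ 2
  vertical : ∀ x ∈ U, vert τ (Y x) (N x) = Real.cosh ϑ

lemma tangent_coord (τ ϑ : ℝ) {p n : R3} (hn : vert τ p n = Real.cosh ϑ) :
    (E3 - Real.cosh ϑ • n) 0 = -Real.cosh ϑ * n 0 ∧
    (E3 - Real.cosh ϑ • n) 1 = -Real.cosh ϑ * n 1 ∧
    vert τ p (E3 - Real.cosh ϑ • n) = 1 - Real.cosh ϑ ^ 2 := by
  unfold vert at *
  refine ⟨by simp [E3], by simp [E3], ?_⟩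
  simp [E3]
  linear_combination -Real.cosh ϑ * hn

/-- The horizontal parts of `n` and `E3 - cosh ϑ n` are parallel, so the product has no
`E₃`-component. In the other components `1 - cosh²ϑ` and `cosh²ϑ` add up to 1. -/
lemma rotTangent_coord (τ ϑ : ℝ) {p n : R3} (hn : vert τ p n = Real.cosh ϑ) :
    cross τ p n (E3 - Real.cosh ϑ • n) 0 = n 1 ∧
    cross τ p n (E3 - Real.cosh ϑ • n) 1 = -n 0 ∧
    vert τ p (cross τ p n (E3 - Real.cosh ϑ • n)) = 0 := by
  obtain ⟨h0, h1, h2⟩ := tangent_coord τ ϑ hn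
  refine ⟨?_, ?_, ?_⟩
  · simp only [cross, h0, h1, h2, hn]
    simp [E1, E2, E3]; ring
  · simp only [cross, h0, h1, h2, hn]
    simp [E1, E2, E3]; ring
  · simp only [cross, h0, h1, h2, hn]
    simp [E1, E2, E3, vert]; ring

lemma vert_add_smul (τ a b : ℝ) (p v w : R3) :
    vert τ p (a • v + b • w) = a * vert τ p v + b * vert τ p w := by
  simp [vert]; ring

namespace LocalHelix

variable {τ ϑ : ℝ} {U : Set R2} {Y N : R2 → R3}

lemma normal_eq (h : LocalHelix τ ϑ U Y N) {x : R2} (hx : x ∈ U) (w : R2) :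
    N x 0 * fderiv ℝ Y x w 0 + N x 1 * fderiv ℝ Y x w 1 =
      Real.cosh ϑ * vert τ (Y x) (fderiv ℝ Y x w) := by
  have := h.normal x hx w
  rw [metric, h.vertical x hx] at this
  linarith

/-- Since `cosh ϑ ≠ 0`, normality recovers the vertical part of a tangent vector from its first two
components, so those two suffice to compare tangent vectors. This reduces (*) to its horizontal
components. -/
lemma fderiv_eq_iff (h : LocalHelix τ ϑ U Y N) {x : R2} (hx : x ∈ U) (w : R2) (a b : ℝ) :
    fderiv ℝ Y x w = a • (E3 - Real.cosh ϑ • N x)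
        + b • cross τ (Y x) (N x) (E3 - Real.cosh ϑ • N x) ↔
      fderiv ℝ Y x w 0 = a * (-Real.cosh ϑ * N x 0) + b * N x 1 ∧
      fderiv ℝ Y x w 1 = a * (-Real.cosh ϑ * N x 1) + b * (-N x 0) := by
  obtain ⟨t0, t1, t2⟩ := tangent_coord τ ϑ (h.vertical x hx)
  obtain ⟨r0, r1, r2⟩ := rotTangent_coord τ ϑ (h.vertical x hx)
  set T := E3 - Real.cosh ϑ • N x
  set J := cross τ (Y x) (N x) T
  have e0 : (a • T + b • J) 0 = a * (-Real.cosh ϑ * N x 0) + b * N x 1 := by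
    simp only [PiLp.add_apply, PiLp.smul_apply, smul_eq_mul, t0, r0]
  have e1 : (a • T + b • J) 1 = a * (-Real.cosh ϑ * N x 1) + b * (-N x 0) := by
    simp only [PiLp.add_apply, PiLp.smul_apply, smul_eq_mul, t1, r1]
  constructor
  · intro hw
    rw [hw]
    exact ⟨e0, e1⟩
  · rintro ⟨h0, h1⟩
    have hv : vert τ (Y x) (fderiv ℝ Y x w) = vert τ (Y x) (a • T + b • J) := by
      rw [vert_add_smul, t2, r2]
      have h2 := h.normal_eq hx w
      rw [h0, h1] at h2
      have hC := (Real.cosh_pos ϑ).ne'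
      apply mul_left_cancel₀ hC
      rw [← h2]
      linear_combination (-(a * Real.cosh ϑ)) * h.horizontal x hx
        + a * Real.cosh ϑ * Real.cosh_sq ϑ
    rw [← e0] at h0
    rw [← e1] at h1
    refine R3.ext_iff'.2 ⟨h0, h1, ?_⟩
    unfold vert at hv
    rw [h0, h1] at hv
    linarith

lemma fderiv_eq_zero (h : LocalHelix τ ϑ U Y N) {x : R2} (hx : x ∈ U) {w : R2}
    (h0 : fderiv ℝ Y x w 0 = 0) (h1 : fderiv ℝ Y x w 1 = 0) : w = 0 := by
  have : fderiv ℝ Y x w = 0 := by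
    have := (h.fderiv_eq_iff hx w 0 0).2 (by simp [h0, h1])
    simpa using this
  exact h.injective x hx (by simpa using this)

/-- The exterior derivative of the relation expressing that `N` is normal. -/
lemma structure_eq (h : LocalHelix τ ϑ U Y N) {x : R2} (hx : x ∈ U) (v w : R2) :
    (fderiv ℝ N x v 0 * fderiv ℝ Y x w 0 + fderiv ℝ N x v 1 * fderiv ℝ Y x w 1)
      - (fderiv ℝ N x w 0 * fderiv ℝ Y x v 0 + fderiv ℝ N x w 1 * fderiv ℝ Y x v 1) =
    2 * τ * Real.cosh ϑ *
      (fderiv ℝ Y x v 0 * fderiv ℝ Y x w 1 - fderiv ℝ Y x w 0 * fderiv ℝ Y x v 1) := by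
  have hY := ContDiffOn.diffAt h.smooth h.isOpen hx
  have hN := ContDiffOn.diffAt h.smooth_normal h.isOpen hx
  have cY : ∀ i, HasFDerivAt (fun y => Y y i) ((coord i).comp (fderiv ℝ Y x)) x := fun i =>
    (coord i).hasFDerivAt.comp x hY.hasFDerivAt
  have cN : ∀ i, HasFDerivAt (fun y => N y i) ((coord i).comp (fderiv ℝ N x)) x := fun i =>
    (coord i).hasFDerivAt.comp x hN.hasFDerivAt
  have cD : ∀ (i) (u : R2), HasFDerivAt (fun y => fderiv ℝ Y y u i)
      ((coord i).comp ((fderiv ℝ (fderiv ℝ Y) x).flip u)) x := fun i u =>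
    (coord i).hasFDerivAt.comp x (fderiv_fderiv_apply h.smooth h.isOpen hx u)
  -- Both sides of the normality relation for the direction `u`, differentiated in the direction
  -- `u'`.
  have key : ∀ u u' : R2,
      N x 0 * fderiv ℝ (fderiv ℝ Y) x u' u 0 + fderiv ℝ Y x u 0 * fderiv ℝ N x u' 0
        + (N x 1 * fderiv ℝ (fderiv ℝ Y) x u' u 1 + fderiv ℝ Y x u 1 * fderiv ℝ N x u' 1) =
      Real.cosh ϑ * (fderiv ℝ (fderiv ℝ Y) x u' u 2
        - τ * (Y x 1 * fderiv ℝ (fderiv ℝ Y) x u' u 0 + fderiv ℝ Y x u 0 * fderiv ℝ Y x u' 1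
        - (Y x 0 * fderiv ℝ (fderiv ℝ Y) x u' u 1 + fderiv ℝ Y x u 1 * fderiv ℝ Y x u' 0))) := by
    intro u u'
    have h1 := ((cN 0).mul (cD 0 u)).add ((cN 1).mul (cD 1 u))
    have h2 := ((cD 2 u).sub ((((cY 1).mul (cD 0 u)).sub ((cY 0).mul (cD 1 u))).const_mul τ)).const_mul
      (Real.cosh ϑ)
    have h3 := h1.unique (h2.congr_of_eventuallyEq (by
      filter_upwards [h.isOpen.mem_nhds hx] with y hy
      exact h.normal_eq hy u))
    have h4 := congrArg (fun L : R2 →L[ℝ] ℝ => L u') h3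
    simpa using h4
  -- Antisymmetrizing cancels the second derivatives of `Y`.
  have k1 := key v w
  have k2 := key w v
  rw [fderiv_fderiv_symm h.smooth h.isOpen hx v w] at k2
  linear_combination k2 - k1

/-- The derivative of the horizontal part of `N` is orthogonal to it. -/
lemma horizontal_deriv (h : LocalHelix τ ϑ U Y N) {x : R2} (hx : x ∈ U) (v : R2) :
    N x 0 * fderiv ℝ N x v 0 + N x 1 * fderiv ℝ N x v 1 = 0 := by
  have hN := ContDiffOn.diffAt h.smooth_normal h.isOpen hx
  have cN : ∀ i, HasFDerivAt (fun y => N y i) ((coord i).comp (fderiv ℝ N x)) x := fun i =>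
    (coord i).hasFDerivAt.comp x hN.hasFDerivAt
  have h1 := ((cN 0).pow 2).add ((cN 1).pow 2)
  have h2 := h1.unique ((hasFDerivAt_const (Real.sinh ϑ ^ 2) x).congr_of_eventuallyEq (by
      filter_upwards [h.isOpen.mem_nhds hx] with y hy
      exact h.horizontal y hy))
  have h3 := congrArg (fun L : R2 →L[ℝ] ℝ => L v) h2
  simp at h3
  linarith

end LocalHelix

/-! ### The normal angle and the directrix. -/

/-- The angle of the horizontal part of the normal, as a function of adapted coordinates. -/
noncomputable def rotAngle (τ ϑ c : ℝ) (x : R2) : ℝ := -2 * τ * Real.cosh ϑ ^ 2 * x 0 + c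

/-- The first component of the directrix of a parametrized surface. -/
noncomputable def directrix₁ (τ ϑ : ℝ) (Y : R2 → R3) (α : R2 → ℝ) (x : R2) : ℝ :=
  Y x 0 - Real.tanh ϑ / (2 * τ) * Real.sin (α x)

/-- The second component of the directrix of a parametrized surface. -/
noncomputable def directrix₂ (τ ϑ : ℝ) (Y : R2 → R3) (α : R2 → ℝ) (x : R2) : ℝ :=
  Y x 1 + Real.tanh ϑ / (2 * τ) * Real.cos (α x)

lemma contDiff_rotAngle (τ ϑ c : ℝ) : ContDiff ℝ ∞ (rotAngle τ ϑ c) :=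
  (contDiff_const.mul (coord (n := 2) 0).contDiff).add contDiff_const

lemma hasFDerivAt_rotAngle (τ ϑ c : ℝ) (x : R2) :
    HasFDerivAt (rotAngle τ ϑ c) ((-2 * τ * Real.cosh ϑ ^ 2) • (coord 0 : R2 →L[ℝ] ℝ)) x :=
  ((coord (n := 2) 0).hasFDerivAt.const_mul _).add_const c

lemma contDiffOn_directrix₁ (τ ϑ : ℝ) {U : Set R2} {Y : R2 → R3} {α : R2 → ℝ}
    (hY : ContDiffOn ℝ ∞ Y U) (hα : ContDiffOn ℝ ∞ α U) :
    ContDiffOn ℝ ∞ (directrix₁ τ ϑ Y α) U :=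
  (contDiffOn_coord hY 0).sub (contDiffOn_const.mul hα.sin)

lemma contDiffOn_directrix₂ (τ ϑ : ℝ) {U : Set R2} {Y : R2 → R3} {α : R2 → ℝ}
    (hY : ContDiffOn ℝ ∞ Y U) (hα : ContDiffOn ℝ ∞ α U) :
    ContDiffOn ℝ ∞ (directrix₂ τ ϑ Y α) U :=
  (contDiffOn_coord hY 1).add (contDiffOn_const.mul hα.cos)

lemma fderiv_directrix₁ (τ ϑ : ℝ) {Y : R2 → R3} {α : R2 → ℝ} {x : R2}
    (hY : DifferentiableAt ℝ Y x) (hα : DifferentiableAt ℝ α x) (w : R2) :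
    fderiv ℝ (directrix₁ τ ϑ Y α) x w =
      fderiv ℝ Y x w 0 - Real.tanh ϑ / (2 * τ) * (Real.cos (α x) * fderiv ℝ α x w) := by
  have h1 : HasFDerivAt (fun y => Y y 0) ((coord 0).comp (fderiv ℝ Y x)) x :=
    (coord 0).hasFDerivAt.comp x hY.hasFDerivAt
  have h2 : HasFDerivAt (directrix₁ τ ϑ Y α) _ x :=
    h1.sub (hα.hasFDerivAt.sin.const_mul (Real.tanh ϑ / (2 * τ)))
  rw [h2.fderiv]
  simp

lemma fderiv_directrix₂ (τ ϑ : ℝ) {Y : R2 → R3} {α : R2 → ℝ} {x : R2}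
    (hY : DifferentiableAt ℝ Y x) (hα : DifferentiableAt ℝ α x) (w : R2) :
    fderiv ℝ (directrix₂ τ ϑ Y α) x w =
      fderiv ℝ Y x w 1 - Real.tanh ϑ / (2 * τ) * (Real.sin (α x) * fderiv ℝ α x w) := by
  have h1 : HasFDerivAt (fun y => Y y 1) ((coord 1).comp (fderiv ℝ Y x)) x :=
    (coord 1).hasFDerivAt.comp x hY.hasFDerivAt
  have h2 : HasFDerivAt (directrix₂ τ ϑ Y α) _ x :=
    h1.add (hα.hasFDerivAt.cos.const_mul (Real.tanh ϑ / (2 * τ)))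
  rw [h2.fderiv]
  simp
  ring

/-! ### From adapted coordinates to the explicit parametrization. -/

namespace LocalHelix

variable {τ ϑ : ℝ} {U : Set R2} {Y N : R2 → R3}

/-- The derivative of the horizontal part of the normal in adapted coordinates. -/
lemma normal_deriv_of_adapted (h : LocalHelix τ ϑ U Y N) (hϑ : 0 < ϑ) {η : ℝ → ℝ}
    (hη : ContDiffOn ℝ ∞ η ((fun x : R2 => x 1) '' U)) {θ : R2 → ℝ}
    (hθ : ∀ x, θ x = η (x 1) - 2 * τ * Real.cosh ϑ ^ 2 * x 0)
    (du0 : ∀ x ∈ U, fderiv ℝ Y x e₀ 0 = -Real.cosh ϑ * N x 0)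
    (du1 : ∀ x ∈ U, fderiv ℝ Y x e₀ 1 = -Real.cosh ϑ * N x 1)
    (dv0 : ∀ x ∈ U, fderiv ℝ Y x e₁ 0 = -Real.sin (θ x) * N x 0 + Real.cos (θ x) * N x 1)
    (dv1 : ∀ x ∈ U, fderiv ℝ Y x e₁ 1 = -Real.sin (θ x) * N x 1 - Real.cos (θ x) * N x 0)
    {x : R2} (hx : x ∈ U) :
    (fderiv ℝ N x e₀ 0 = 2 * τ * Real.cosh ϑ ^ 2 * N x 1 ∧
      fderiv ℝ N x e₀ 1 = -(2 * τ * Real.cosh ϑ ^ 2) * N x 0) ∧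
    fderiv ℝ N x e₁ 0 = 0 ∧ fderiv ℝ N x e₁ 1 = 0 := by
  have hC : Real.cosh ϑ ≠ 0 := (Real.cosh_pos ϑ).ne'
  have hS : Real.sinh ϑ ^ 2 ≠ 0 := (pow_pos (Real.sinh_pos_iff.2 hϑ) 2).ne'
  -- Otherwise `∂_v` would be a multiple of `∂_u`, against the immersion property.
  have hcos : Real.cos (θ x) ≠ 0 := by
    intro h0
    have hz : e₁ - (Real.sin (θ x) / Real.cosh ϑ) • e₀ = 0 := by
      apply h.fderiv_eq_zero hx
      · rw [map_sub, map_smul, PiLp.sub_apply, PiLp.smul_apply, smul_eq_mul, du0 x hx, dv0 x hx, h0]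
        field_simp; ring
      · rw [map_sub, map_smul, PiLp.sub_apply, PiLp.smul_apply, smul_eq_mul, du1 x hx, dv1 x hx, h0]
        field_simp; ring
    have := congrArg (fun w : R2 => w 1) hz
    simp at this
  have hhor := h.horizontal x hx
  have o0 := h.horizontal_deriv hx e₀
  have o1 := h.horizontal_deriv hx e₁
  have st := h.structure_eq hx e₀ e₁
  rw [du0 x hx, du1 x hx, dv0 x hx, dv1 x hx] at st
  -- In the structure equation the terms along the horizontal normal vanish, since its length is
  -- constant; `cos θ` then factors out of both sides.
  have hP : N x 1 * fderiv ℝ N x e₀ 0 - N x 0 * fderiv ℝ N x e₀ 1 =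
      2 * τ * Real.cosh ϑ ^ 2 * Real.sinh ϑ ^ 2 := by
    apply mul_left_cancel₀ hcos
    linear_combination st + Real.sin (θ x) * o0 - Real.cosh ϑ * o1
      + 2 * τ * Real.cosh ϑ ^ 2 * Real.cos (θ x) * hhor
  -- `o0` and `hP` give the components of `∂_u N` along and across the horizontal normal, whose
  -- squared length is `sinh²ϑ`.
  have hA0 : fderiv ℝ N x e₀ 0 = 2 * τ * Real.cosh ϑ ^ 2 * N x 1 := by
    apply mul_left_cancel₀ hS
    linear_combination N x 1 * hP + N x 0 * o0 - fderiv ℝ N x e₀ 0 * hhor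
  have hA1 : fderiv ℝ N x e₀ 1 = -(2 * τ * Real.cosh ϑ ^ 2) * N x 0 := by
    apply mul_left_cancel₀ hS
    linear_combination -N x 0 * hP + N x 1 * o0 - fderiv ℝ N x e₀ 1 * hhor
  refine ⟨⟨hA0, hA1⟩, ?_⟩
  have hN := ContDiffOn.diffAt h.smooth_normal h.isOpen hx
  have cN : ∀ i, HasFDerivAt (fun y => N y i) ((coord i).comp (fderiv ℝ N x)) x := fun i =>
    (coord i).hasFDerivAt.comp x hN.hasFDerivAt
  have cD : ∀ (i) (u : R2), HasFDerivAt (fun y => fderiv ℝ Y y u i)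
      ((coord i).comp ((fderiv ℝ (fderiv ℝ Y) x).flip u)) x := fun i u =>
    (coord i).hasFDerivAt.comp x (fderiv_fderiv_apply h.smooth h.isOpen hx u)
  have c0 : HasFDerivAt (fun y : R2 => y 0) (coord 0 : R2 →L[ℝ] ℝ) x := (coord 0).hasFDerivAt
  have c1 : HasFDerivAt (fun y : R2 => y 1) (coord 1 : R2 →L[ℝ] ℝ) x := (coord 1).hasFDerivAt
  have hev := h.isOpen.mem_nhds hx
  have hθd : HasFDerivAt θ ((deriv η (x 1)) • (coord 1 : R2 →L[ℝ] ℝ)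
      - (2 * τ * Real.cosh ϑ ^ 2) • (coord 0 : R2 →L[ℝ] ℝ)) x := by
    have h1 : HasDerivAt η (deriv η (x 1)) (x 1) :=
      (ContDiffOn.diffAt hη (isOpen_image_coord_one h.isOpen) ⟨x, hx, rfl⟩).hasDerivAt
    have h2 := h1.comp_hasFDerivAt x c1
    have h3 := h2.sub (c0.const_mul (2 * τ * Real.cosh ϑ ^ 2))
    rwa [show θ = fun x => η (x 1) - 2 * τ * Real.cosh ϑ ^ 2 * x 0 from funext hθ]
  -- The horizontal part of `∂_v Y` does not depend on `u`, because `θ` and the normal rotate at the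
  -- same rate; so `∂_v ∂_u Y`, horizontally `-cosh ϑ ∂_v N`, vanishes there.
  have sy := fderiv_fderiv_symm h.smooth h.isOpen hx e₀ e₁
  constructor
  · have a1 := (cD 0 e₀).unique (((cN 0).const_mul (-Real.cosh ϑ)).congr_of_eventuallyEq
      (by filter_upwards [hev] with y hy using du0 y hy))
    have a2 := (cD 0 e₁).unique (((hθd.sin.neg.mul (cN 0)).add
      (hθd.cos.mul (cN 1))).congr_of_eventuallyEq
      (by filter_upwards [hev] with y hy using dv0 y hy))
    have b1 := congrArg (fun L : R2 →L[ℝ] ℝ => L e₁) a1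
    have b2 := congrArg (fun L : R2 →L[ℝ] ℝ => L e₀) a2
    simp at b1 b2
    rw [sy, b1, hA0, hA1] at b2
    apply mul_left_cancel₀ hC
    linear_combination -b2
  · have a1 := (cD 1 e₀).unique (((cN 1).const_mul (-Real.cosh ϑ)).congr_of_eventuallyEq
      (by filter_upwards [hev] with y hy using du1 y hy))
    have a2 := (cD 1 e₁).unique (((hθd.sin.neg.mul (cN 1)).sub
      (hθd.cos.mul (cN 0))).congr_of_eventuallyEq
      (by filter_upwards [hev] with y hy using dv1 y hy))
    have b1 := congrArg (fun L : R2 →L[ℝ] ℝ => L e₁) a1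
    have b2 := congrArg (fun L : R2 →L[ℝ] ℝ => L e₀) a2
    simp at b1 b2
    rw [sy, b1, hA0, hA1] at b2
    apply mul_left_cancel₀ hC
    linear_combination -b2

/-- In adapted coordinates the horizontal part of the normal rotates uniformly. -/
lemma exists_normal_eq (h : LocalHelix τ ϑ U Y N) (hϑ : 0 < ϑ) (hc : Convex ℝ U)
    (hN : ∀ x ∈ U, (fderiv ℝ N x e₀ 0 = 2 * τ * Real.cosh ϑ ^ 2 * N x 1 ∧
      fderiv ℝ N x e₀ 1 = -(2 * τ * Real.cosh ϑ ^ 2) * N x 0) ∧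
      fderiv ℝ N x e₁ 0 = 0 ∧ fderiv ℝ N x e₁ 1 = 0) :
    ∃ c : ℝ, ∀ x ∈ U,
      N x 0 = Real.sinh ϑ * Real.cos (-2 * τ * Real.cosh ϑ ^ 2 * x 0 + c) ∧
      N x 1 = Real.sinh ϑ * Real.sin (-2 * τ * Real.cosh ϑ ^ 2 * x 0 + c) := by
  set k := -2 * τ * Real.cosh ϑ ^ 2 with hk
  have cN : ∀ i, ∀ x ∈ U, HasFDerivAt (fun y => N y i) ((coord i).comp (fderiv ℝ N x)) x :=
    fun i x hx => (coord i).hasFDerivAt.comp x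
      (ContDiffOn.diffAt h.smooth_normal h.isOpen hx).hasFDerivAt
  have hlin : ∀ x : R2, HasFDerivAt (fun y : R2 => k * y 0) (k • (coord 0 : R2 →L[ℝ] ℝ)) x :=
    fun x => (coord (n := 2) 0).hasFDerivAt.const_mul k
  -- `d1` and `d2` concern the real and imaginary parts of `(N₀ + i N₁) e^{-iku}`, the normal
  -- rotated back. Its constant value has argument `c`.
  have d1 : ∀ x ∈ U, HasFDerivAt
      (fun y : R2 => N y 0 * Real.cos (k * y 0) + N y 1 * Real.sin (k * y 0)) (0 : R2 →L[ℝ] ℝ) x := by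
    intro x hx
    obtain ⟨⟨a0, a1⟩, b0, b1⟩ := hN x hx
    refine (((cN 0 x hx).mul (hlin x).cos).add ((cN 1 x hx).mul (hlin x).sin)).congr_fderiv ?_
    ext w
    simp [map_R2 (fderiv ℝ N x) w, a0, a1, b0, b1, hk]
    ring
  have d2 : ∀ x ∈ U, HasFDerivAt
      (fun y : R2 => N y 1 * Real.cos (k * y 0) - N y 0 * Real.sin (k * y 0)) (0 : R2 →L[ℝ] ℝ) x := by
    intro x hx
    obtain ⟨⟨a0, a1⟩, b0, b1⟩ := hN x hx
    refine (((cN 1 x hx).mul (hlin x).cos).sub ((cN 0 x hx).mul (hlin x).sin)).congr_fderiv ?_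
    ext w
    simp [map_R2 (fderiv ℝ N x) w, a0, a1, b0, b1, hk]
    ring
  obtain ⟨m1, hm1⟩ := h.isOpen.exists_is_const_of_fderiv_eq_zero hc.isPreconnected
    (fun x hx => (d1 x hx).differentiableAt.differentiableWithinAt) (fun x hx => (d1 x hx).fderiv)
  obtain ⟨m2, hm2⟩ := h.isOpen.exists_is_const_of_fderiv_eq_zero hc.isPreconnected
    (fun x hx => (d2 x hx).differentiableAt.differentiableWithinAt) (fun x hx => (d2 x hx).fderiv)
  rcases U.eq_empty_or_nonempty with rfl | ⟨x₀, hx₀⟩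
  · exact ⟨0, by simp⟩
  obtain ⟨c, hc1, hc2⟩ : ∃ c : ℝ, m1 = Real.sinh ϑ * Real.cos c ∧ m2 = Real.sinh ϑ * Real.sin c := by
    refine exists_polar (Real.sinh_pos_iff.2 hϑ) ?_
    rw [← hm1 x₀ hx₀, ← hm2 x₀ hx₀, ← h.horizontal x₀ hx₀]
    linear_combination (N x₀ 0 ^ 2 + N x₀ 1 ^ 2) * Real.sin_sq_add_cos_sq (k * x₀ 0)
  refine ⟨c, fun x hx => ?_⟩
  have e1 := hm1 x hx
  have e2 := hm2 x hx
  rw [hc1] at e1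
  rw [hc2] at e2
  have hsc := Real.sin_sq_add_cos_sq (k * x 0)
  rw [Real.cos_add, Real.sin_add]
  constructor
  · linear_combination Real.cos (k * x 0) * e1 - Real.sin (k * x 0) * e2 - N x 0 * hsc
  · linear_combination Real.sin (k * x 0) * e1 + Real.cos (k * x 0) * e2 - N x 1 * hsc

/-- The parametrization of a helix surface in adapted coordinates. -/
theorem exists_helixParam (h : LocalHelix τ ϑ U Y N) (hτ : τ ≠ 0) (hϑ : 0 < ϑ) (hc : Convex ℝ U)
    {η : ℝ → ℝ} (hη : ContDiffOn ℝ ∞ η ((fun x : R2 => x 1) '' U)) {θ : R2 → ℝ}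
    (hθ : ∀ x, θ x = η (x 1) - 2 * τ * Real.cosh ϑ ^ 2 * x 0)
    (du0 : ∀ x ∈ U, fderiv ℝ Y x e₀ 0 = -Real.cosh ϑ * N x 0)
    (du1 : ∀ x ∈ U, fderiv ℝ Y x e₀ 1 = -Real.cosh ϑ * N x 1)
    (dv0 : ∀ x ∈ U, fderiv ℝ Y x e₁ 0 = -Real.sin (θ x) * N x 0 + Real.cos (θ x) * N x 1)
    (dv1 : ∀ x ∈ U, fderiv ℝ Y x e₁ 1 = -Real.sin (θ x) * N x 1 - Real.cos (θ x) * N x 0) :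
    ∃ (c : ℝ) (f₁ f₂ f₃ : ℝ → ℝ),
      ContDiffOn ℝ ∞ f₁ ((fun x : R2 => x 1) '' U) ∧
      ContDiffOn ℝ ∞ f₂ ((fun x : R2 => x 1) '' U) ∧
      ContDiffOn ℝ ∞ f₃ ((fun x : R2 => x 1) '' U) ∧
      (∀ v ∈ (fun x : R2 => x 1) '' U, deriv f₁ v ^ 2 + deriv f₂ v ^ 2 = Real.sinh ϑ ^ 2) ∧
      (∀ v ∈ (fun x : R2 => x 1) '' U,
        deriv f₃ v = τ * (f₂ v * deriv f₁ v - f₁ v * deriv f₂ v)) ∧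
      ∀ x ∈ U, Y x = helixParam τ ϑ f₁ f₂ f₃ (-2 * τ * Real.cosh ϑ ^ 2 * x 0 + c) (x 1) := by
  obtain ⟨c, hN⟩ := h.exists_normal_eq hϑ hc
    fun x hx => h.normal_deriv_of_adapted hϑ hη hθ du0 du1 dv0 dv1 hx
  have hC : Real.cosh ϑ ≠ 0 := (Real.cosh_pos ϑ).ne'
  have ht : Real.tanh ϑ = Real.sinh ϑ / Real.cosh ϑ := Real.tanh_eq_sinh_div_cosh ϑ
  set α := rotAngle τ ϑ c with hα
  have hαx : ∀ x : R2, -2 * τ * Real.cosh ϑ ^ 2 * x 0 + c = α x := fun x => rfl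
  simp only [hαx] at hN
  have hαs : ContDiff ℝ ∞ α := contDiff_rotAngle τ ϑ c
  have hαd := hasFDerivAt_rotAngle τ ϑ c
  have dY : ∀ x ∈ U, DifferentiableAt ℝ Y x := fun x hx =>
    ContDiffOn.diffAt h.smooth h.isOpen hx
  have cY2 : ∀ x ∈ U, HasFDerivAt (fun y => Y y 2) ((coord 2).comp (fderiv ℝ Y x)) x :=
    fun x hx => (coord 2).hasFDerivAt.comp x (dY x hx).hasFDerivAt
  set F₁ := directrix₁ τ ϑ Y α with hF₁
  set F₂ := directrix₂ τ ϑ Y α with hF₂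
  -- The third component of the parametrization solved for `f₃`.
  set F₃ : R2 → ℝ := fun x => Y x 2 - Real.tanh ϑ ^ 2 / (4 * τ) * α x
    - Real.tanh ϑ / 2 * (F₁ x * Real.cos (α x) + F₂ x * Real.sin (α x)) with hF₃
  have s₁ : ContDiffOn ℝ ∞ F₁ U := contDiffOn_directrix₁ τ ϑ h.smooth hαs.contDiffOn
  have s₂ : ContDiffOn ℝ ∞ F₂ U := contDiffOn_directrix₂ τ ϑ h.smooth hαs.contDiffOn
  have s₃ : ContDiffOn ℝ ∞ F₃ U :=
    ((contDiffOn_coord h.smooth 2).sub (contDiffOn_const.mul hαs.contDiffOn)).sub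
      (contDiffOn_const.mul ((s₁.mul hαs.cos.contDiffOn).add (s₂.mul hαs.sin.contDiffOn)))
  have dα0 : ∀ x, fderiv ℝ α x e₀ = -2 * τ * Real.cosh ϑ ^ 2 := fun x => by
    rw [(hαd x).fderiv]; simp
  have dα1 : ∀ x, fderiv ℝ α x e₁ = 0 := fun x => by
    rw [(hαd x).fderiv]; simp
  have D₁ := fun x hx => fderiv_directrix₁ τ ϑ (dY x hx) (hαd x).differentiableAt
  have D₂ := fun x hx => fderiv_directrix₂ τ ϑ (dY x hx) (hαd x).differentiableAt
  have p₁ : ∀ x ∈ U, fderiv ℝ F₁ x e₀ = 0 := by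
    intro x hx
    rw [hF₁, D₁ x hx, dα0, du0 x hx, (hN x hx).1, ht]
    field_simp; ring
  have p₂ : ∀ x ∈ U, fderiv ℝ F₂ x e₀ = 0 := by
    intro x hx
    rw [hF₂, D₂ x hx, dα0, du1 x hx, (hN x hx).2, ht]
    field_simp; ring
  have q₁ : ∀ x ∈ U, fderiv ℝ F₁ x e₁ = -Real.sin (θ x) * N x 0 + Real.cos (θ x) * N x 1 := by
    intro x hx
    rw [hF₁, D₁ x hx, dα1, dv0 x hx]; ring
  have q₂ : ∀ x ∈ U, fderiv ℝ F₂ x e₁ = -Real.sin (θ x) * N x 1 - Real.cos (θ x) * N x 0 := by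
    intro x hx
    rw [hF₂, D₂ x hx, dα1, dv1 x hx]; ring
  have D₃ : ∀ x ∈ U, ∀ w, fderiv ℝ F₃ x w = fderiv ℝ Y x w 2
      - Real.tanh ϑ ^ 2 / (4 * τ) * fderiv ℝ α x w
      - Real.tanh ϑ / 2 * ((F₂ x * Real.cos (α x) - F₁ x * Real.sin (α x)) * fderiv ℝ α x w
        + (Real.cos (α x) * fderiv ℝ F₁ x w + Real.sin (α x) * fderiv ℝ F₂ x w)) := by
    intro x hx w
    have a₁ := (ContDiffOn.diffAt s₁ h.isOpen hx).hasFDerivAt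
    have a₂ := (ContDiffOn.diffAt s₂ h.isOpen hx).hasFDerivAt
    have aα := (hαd x).differentiableAt.hasFDerivAt
    have a₃ : HasFDerivAt F₃ _ x :=
      ((cY2 x hx).sub (aα.const_mul (Real.tanh ϑ ^ 2 / (4 * τ)))).sub
        (((a₁.mul aα.cos).add (a₂.mul aα.sin)).const_mul (Real.tanh ϑ / 2))
    rw [a₃.fderiv]
    simp
    ring
  -- Normality solved for `dz`: the only source of information on the height, used in both `p₃` and
  -- `q₃`.
  have hv : ∀ x ∈ U, ∀ w, fderiv ℝ Y x w 2 =
      τ * (Y x 1 * fderiv ℝ Y x w 0 - Y x 0 * fderiv ℝ Y x w 1)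
        + (N x 0 * fderiv ℝ Y x w 0 + N x 1 * fderiv ℝ Y x w 1) / Real.cosh ϑ := by
    intro x hx w
    rw [h.normal_eq hx w, mul_div_cancel_left₀ _ hC, vert]
    ring
  have hY0 : ∀ x, Y x 0 = F₁ x + Real.tanh ϑ / (2 * τ) * Real.sin (α x) := fun x => by
    rw [hF₁, directrix₁]; ring
  have hY1 : ∀ x, Y x 1 = F₂ x - Real.tanh ϑ / (2 * τ) * Real.cos (α x) := fun x => by
    rw [hF₂, directrix₂]; ring
  have p₃ : ∀ x ∈ U, fderiv ℝ F₃ x e₀ = 0 := by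
    intro x hx
    have hsc := Real.sin_sq_add_cos_sq (α x)
    rw [D₃ x hx, p₁ x hx, p₂ x hx, dα0, hv x hx, du0 x hx, du1 x hx, hY0, hY1, (hN x hx).1,
      (hN x hx).2, ht]
    field_simp
    linear_combination (-4 : ℝ) * Real.sinh ϑ ^ 2 * Real.cosh ϑ * hsc
  have q₃ : ∀ x ∈ U, fderiv ℝ F₃ x e₁ =
      τ * (F₂ x * fderiv ℝ F₁ x e₁ - F₁ x * fderiv ℝ F₂ x e₁) := by
    intro x hx
    rw [D₃ x hx, q₁ x hx, q₂ x hx, dα1, hv x hx, dv0 x hx, dv1 x hx, hY0, hY1, (hN x hx).1,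
      (hN x hx).2, ht]
    field_simp
    ring
  obtain ⟨f₁, S₁, E₁, G₁⟩ := exists_eq_comp_coord_one h.isOpen hc s₁ p₁
  obtain ⟨f₂, S₂, E₂, G₂⟩ := exists_eq_comp_coord_one h.isOpen hc s₂ p₂
  obtain ⟨f₃, S₃, E₃, G₃⟩ := exists_eq_comp_coord_one h.isOpen hc s₃ p₃
  refine ⟨c, f₁, f₂, f₃, S₁, S₂, S₃, ?_, ?_, ?_⟩
  · rintro _ ⟨x, hx, rfl⟩
    have hsc := Real.sin_sq_add_cos_sq (θ x)
    simp only [(G₁ x hx).deriv, (G₂ x hx).deriv, q₁ x hx, q₂ x hx]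
    rw [← h.horizontal x hx]
    linear_combination (N x 0 ^ 2 + N x 1 ^ 2) * hsc
  · rintro _ ⟨x, hx, rfl⟩
    simp only [(G₁ x hx).deriv, (G₂ x hx).deriv, (G₃ x hx).deriv, ← E₁ x hx, ← E₂ x hx]
    exact q₃ x hx
  · intro x hx
    refine R3.ext_iff'.2 ⟨?_, ?_, ?_⟩
    · simp [helixParam, ← E₁ x hx, ← E₂ x hx, ← E₃ x hx]
      rw [hY0, hα, rotAngle]; ring_nf
    · simp [helixParam, ← E₁ x hx, ← E₂ x hx, ← E₃ x hx]
      rw [hY1, hα, rotAngle]; ring_nf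
    · simp [helixParam, ← E₁ x hx, ← E₂ x hx, ← E₃ x hx]
      rw [hF₃, hα]; simp only [rotAngle]; ring_nf

end LocalHelix

/-! ### Passage between the surface and its charts. -/

section

variable {M : Type*} [TopologicalSpace M] [ChartedSpace R2 M]

lemma IsHelixSpacelike.vert_eq {τ ϑ : ℝ} {X N : M → R3} (hM : IsHelixSpacelike τ ϑ X N) (p : M) :
    vert τ (X p) (N p) = Real.cosh ϑ := by
  rw [← hM.angle p, angleFn, hM.unitNormal.unit p]
  simp [metric, E3, vert]

lemma IsHelixSpacelike.tangentPart_eq {τ ϑ : ℝ} {X N : M → R3} (hM : IsHelixSpacelike τ ϑ X N)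
    (p : M) : tangentPart τ X N p = E3 - Real.cosh ϑ • N p := by
  rw [tangentPart, hM.angle p]

lemma IsHelixSpacelike.rotTangentPart_eq {τ ϑ : ℝ} {X N : M → R3}
    (hM : IsHelixSpacelike τ ϑ X N) (p : M) :
    rotTangentPart τ X N p = cross τ (X p) (N p) (E3 - Real.cosh ϑ • N p) := by
  rw [rotTangentPart, hM.tangentPart_eq]

lemma mdifferentiable_of_mem_maximalAtlas {e : OpenPartialHomeomorph M R2}
    (he : e ∈ IsManifold.maximalAtlas (𝓡 2) ∞ M) : e.MDifferentiable (𝓡 2) (𝓡 2) :=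
  ⟨(contMDiffOn_of_mem_maximalAtlas he).mdifferentiableOn (by simp),
    (contMDiffOn_symm_of_mem_maximalAtlas he).mdifferentiableOn (by simp)⟩

/-- A helix surface read in a chart. -/
lemma IsHelixSpacelike.localHelix {τ ϑ : ℝ} {X N : M → R3} (hM : IsHelixSpacelike τ ϑ X N)
    {e : OpenPartialHomeomorph M R2} (he : e ∈ IsManifold.maximalAtlas (𝓡 2) ∞ M) :
    LocalHelix τ ϑ e.target (fun y => X (e.symm y)) (fun y => N (e.symm y)) := by
  have hd := mdifferentiable_of_mem_maximalAtlas he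
  have hs := contMDiffOn_symm_of_mem_maximalAtlas he
  have key : ∀ x ∈ e.target, fderiv ℝ (fun y => X (e.symm y)) x =
      (mfderiv (𝓡 2) (𝓡 3) X (e.symm x)).comp (mfderiv (𝓡 2) (𝓡 2) e.symm x) := by
    intro x hx
    rw [← mfderiv_eq_fderiv]
    exact mfderiv_comp x (hM.spacelike.smooth.mdifferentiable (by simp) _)
      (hd.mdifferentiableAt_symm hx)
  refine ⟨e.open_target, ?_, ?_, ?_, ?_, ?_, fun x _ => hM.vert_eq _⟩
  · exact contMDiffOn_iff_contDiffOn.1 (hM.spacelike.smooth.comp_contMDiffOn hs)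
  · exact contMDiffOn_iff_contDiffOn.1 (hM.unitNormal.smooth.comp_contMDiffOn hs)
  · intro x hx
    rw [key x hx]
    exact (hM.spacelike.immersion _).comp (hd.symm.mfderiv_injective hx)
  · intro x hx w
    rw [key x hx]
    exact hM.unitNormal.normal _ _
  · intro x _
    have h1 := hM.unitNormal.unit (e.symm x)
    rw [metric, hM.vert_eq] at h1
    linear_combination h1 + Real.cosh_sq ϑ

variable [IsManifold (𝓡 2) ∞ M]

/-- The inverse function theorem for charts: a smooth map of the plane with injective derivative
turns a chart into another one near a given point. -/
lemma exists_chart_comp {e : OpenPartialHomeomorph M R2}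
    (he : e ∈ IsManifold.maximalAtlas (𝓡 2) ∞ M) {W : Set R2} (hW : IsOpen W) (hWe : W ⊆ e.target)
    {Φ : R2 → R2} (hΦ : ContDiffOn ℝ ∞ Φ W) {x₀ : R2} (hx₀ : x₀ ∈ W)
    (hinj : Function.Injective (fderiv ℝ Φ x₀)) :
    ∃ e' ∈ IsManifold.maximalAtlas (𝓡 2) ∞ M, e.symm x₀ ∈ e'.source ∧ Convex ℝ e'.target ∧
      ∀ p ∈ e'.source, p ∈ e.source ∧ e p ∈ W ∧ e' p = Φ (e p) := by
  have hcont : ContinuousOn (fderiv ℝ Φ) W :=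
    hΦ.continuousOn_fderiv_of_isOpen hW (by simp)
  have hequiv : ∀ L : R2 →L[ℝ] R2, Function.Injective L → ∃ L' : R2 ≃L[ℝ] R2, (L' : R2 →L[ℝ] R2) = L :=
    fun L hL => ⟨(LinearEquiv.ofInjectiveEndo (L : R2 →ₗ[ℝ] R2) hL).toContinuousLinearEquiv, by
      ext1 x; rfl⟩
  -- Invertibility of the derivative is kept on the whole domain, so that the local inverse is
  -- smooth everywhere on it and not merely at one point.
  let W' : Set R2 := W ∩ fderiv ℝ Φ ⁻¹' (range ((↑) : (R2 ≃L[ℝ] R2) → R2 →L[ℝ] R2))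
  have hW' : IsOpen W' := hcont.isOpen_inter_preimage hW (ContinuousLinearEquiv.isOpen)
  have hx₀' : x₀ ∈ W' := ⟨hx₀, hequiv _ hinj⟩
  obtain ⟨L₀, hL₀⟩ := hx₀'.2
  have hat : ContDiffAt ℝ ∞ Φ x₀ := hΦ.contDiffAt (hW.mem_nhds hx₀)
  have hder : HasFDerivAt Φ (L₀ : R2 →L[ℝ] R2) x₀ := by
    rw [hL₀]; exact (hat.differentiableAt (by simp)).hasFDerivAt
  let ψ := (hat.toOpenPartialHomeomorph Φ hder (by simp)).restrOpen W' hW'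
  have hψ : ∀ x, ψ x = Φ x := fun x => rfl
  have hsrc : x₀ ∈ ψ.source := ⟨hat.mem_toOpenPartialHomeomorph_source hder (by simp), hx₀'⟩
  have hsub : ψ.source ⊆ W' := fun x hx => hx.2
  have hy₀ : Φ x₀ ∈ ψ.target := ψ.map_source hsrc
  obtain ⟨r, hr, hball⟩ := Metric.isOpen_iff.1 ψ.open_target _ hy₀
  -- Shrinking the image to a ball makes the range of the new chart convex.
  let χ := ψ.symm.restrOpen (Metric.ball (Φ x₀) r) Metric.isOpen_ball
  have hχs : χ.source = Metric.ball (Φ x₀) r := inter_eq_right.2 hball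
  have hχW : χ.target ⊆ W' := fun x hx => hsub hx.1
  have hsymm : ContDiffOn ℝ ∞ χ χ.source := by
    rw [hχs]
    intro y hy
    have hyt : y ∈ ψ.target := hball hy
    obtain ⟨hxW, L, hL⟩ := hsub (ψ.map_target hyt)
    have hc : ContDiffAt ℝ ∞ Φ (ψ.symm y) := hΦ.contDiffAt (hW.mem_nhds hxW)
    refine (ψ.contDiffAt_symm (f₀' := L) hyt ?_ hc).contDiffWithinAt
    rw [hL]
    exact (hc.differentiableAt (by simp)).hasFDerivAt
  have htarget : (e.trans χ.symm).target = Metric.ball (Φ x₀) r := by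
    rw [OpenPartialHomeomorph.trans_target]
    simp only [OpenPartialHomeomorph.symm_target, OpenPartialHomeomorph.symm_symm, hχs]
    refine inter_eq_left.2 fun y hy => hWe (hχW (χ.map_source (hχs ▸ hy))).1
  have hval : ∀ p, (e.trans χ.symm) p = Φ (e p) := fun p => rfl
  refine ⟨e.trans χ.symm, ?_, ?_, ?_, ?_⟩
  · refine OpenPartialHomeomorph.mem_maximalAtlas_of_contMDiffOn _ ?_ ?_
    · refine (contMDiffOn_iff_contDiffOn.2 (hΦ.mono fun x hx => hx)).comp
        ((contMDiffOn_of_mem_maximalAtlas he).mono fun p hp => hp.1) fun p hp => (hχW hp.2).1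
    · have h1 : ContMDiffOn (𝓡 2) (𝓡 2) ∞ χ χ.source := contMDiffOn_iff_contDiffOn.2 hsymm
      refine (contMDiffOn_symm_of_mem_maximalAtlas he).comp
        (h1.mono fun y hy => hy.1) fun y hy => hy.2
  · refine ⟨e.map_target (hWe hx₀), ?_⟩
    change e (e.symm x₀) ∈ χ.target
    rw [e.right_inv (hWe hx₀)]
    refine ⟨hsrc, ?_⟩
    change ψ x₀ ∈ Metric.ball (Φ x₀) r
    exact Metric.mem_ball_self hr
  · rw [htarget]; exact convex_ball _ _
  · intro p hp
    exact ⟨hp.1, (hχW hp.2).1, rfl⟩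

end

lemma contDiffOn_pair {a b : R2 → ℝ} {U : Set R2} (ha : ContDiffOn ℝ ∞ a U)
    (hb : ContDiffOn ℝ ∞ b U) : ContDiffOn ℝ ∞ (fun x => (!₂[a x, b x] : R2)) U := by
  rw [contDiffOn_euclidean]
  intro i
  fin_cases i
  · simpa using ha
  · simpa using hb

lemma injective_fderiv_pair {a b : R2 → ℝ} {x : R2}
    (hd : DifferentiableAt ℝ (fun x => (!₂[a x, b x] : R2)) x)
    (h : ∀ w, fderiv ℝ a x w = 0 → fderiv ℝ b x w = 0 → w = 0) :
    Function.Injective (fderiv ℝ (fun x => (!₂[a x, b x] : R2)) x) := by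
  rw [injective_iff_map_eq_zero]
  intro w hw
  have h0 := fderiv_coord hd 0 w
  have h1 := fderiv_coord hd 1 w
  rw [hw] at h0 h1
  exact h w (by simpa using h0) (by simpa using h1)

/-! ### Coordinates built from the normal angle and the directrix. -/

namespace LocalHelix

variable {τ ϑ : ℝ} {U V : Set R2} {Y N : R2 → R3} {α : R2 → ℝ}

lemma fderiv_normal (h : LocalHelix τ ϑ U Y N) (hV : IsOpen V) (hVU : V ⊆ U)
    (hα : ContDiffOn ℝ ∞ α V)
    (hN : ∀ x ∈ V, N x 0 = Real.sinh ϑ * Real.cos (α x) ∧ N x 1 = Real.sinh ϑ * Real.sin (α x))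
    {x : R2} (hx : x ∈ V) (w : R2) :
    fderiv ℝ N x w 0 = -(N x 1 * fderiv ℝ α x w) ∧ fderiv ℝ N x w 1 = N x 0 * fderiv ℝ α x w := by
  have hNd := ContDiffOn.diffAt h.smooth_normal h.isOpen (hVU hx)
  have cN : ∀ i, HasFDerivAt (fun y => N y i) ((coord i).comp (fderiv ℝ N x)) x := fun i =>
    (coord i).hasFDerivAt.comp x hNd.hasFDerivAt
  have hαd := (ContDiffOn.diffAt hα hV hx).hasFDerivAt
  have h0 := (cN 0).unique ((hαd.cos.const_mul (Real.sinh ϑ)).congr_of_eventuallyEq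
    (by filter_upwards [hV.mem_nhds hx] with y hy using (hN y hy).1))
  have h1 := (cN 1).unique ((hαd.sin.const_mul (Real.sinh ϑ)).congr_of_eventuallyEq
    (by filter_upwards [hV.mem_nhds hx] with y hy using (hN y hy).2))
  have k0 := congrArg (fun L : R2 →L[ℝ] ℝ => L w) h0
  have k1 := congrArg (fun L : R2 →L[ℝ] ℝ => L w) h1
  simp at k0 k1
  rw [k0, k1, (hN x hx).1, (hN x hx).2]
  constructor <;> ring

/-- The angle of the normal and one component of the directrix are independent. -/
lemma exists_independent (h : LocalHelix τ ϑ U Y N) (hτ : τ ≠ 0) (hV : IsOpen V) (hVU : V ⊆ U)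
    (hα : ContDiffOn ℝ ∞ α V)
    (hN : ∀ x ∈ V, N x 0 = Real.sinh ϑ * Real.cos (α x) ∧ N x 1 = Real.sinh ϑ * Real.sin (α x))
    {x : R2} (hx : x ∈ V) :
    (∀ w, fderiv ℝ α x w = 0 → fderiv ℝ (directrix₁ τ ϑ Y α) x w = 0 → w = 0) ∨
    (∀ w, fderiv ℝ α x w = 0 → fderiv ℝ (directrix₂ τ ϑ Y α) x w = 0 → w = 0) := by
  have hY := ContDiffOn.diffAt h.smooth h.isOpen (hVU hx)
  have hαd := ContDiffOn.diffAt hα hV hx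
  by_contra! hcon
  obtain ⟨⟨v, hv, hv', hv0⟩, w, hw, hw', hw0⟩ := hcon
  rw [fderiv_directrix₁ τ ϑ hY hαd, hv, mul_zero, mul_zero, sub_zero] at hv'
  rw [fderiv_directrix₂ τ ϑ hY hαd, hw, mul_zero, mul_zero, sub_zero] at hw'
  have hst := h.structure_eq (hVU hx) v w
  rw [(h.fderiv_normal hV hVU hα hN hx v).1, (h.fderiv_normal hV hVU hα hN hx v).2,
    (h.fderiv_normal hV hVU hα hN hx w).1, (h.fderiv_normal hV hVU hα hN hx w).2, hv, hw, hv',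
    hw'] at hst
  -- Both vectors kill `dα`, hence also `dN₀` and `dN₁`. The structure equation then forces `dx ∧
  -- dy` to vanish on them, although `v` is a nonzero vector with `dx = 0` and `w` one with `dy =
  -- 0`.
  have hv1 : fderiv ℝ Y x v 1 ≠ 0 := fun h1 => hv0 (h.fderiv_eq_zero (hVU hx) hv' h1)
  have hw1 : fderiv ℝ Y x w 0 ≠ 0 := fun h1 => hw0 (h.fderiv_eq_zero (hVU hx) h1 hw')
  have hC := (Real.cosh_pos ϑ).ne'
  have : 2 * τ * Real.cosh ϑ * (fderiv ℝ Y x w 0 * fderiv ℝ Y x v 1) = 0 := by linarith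
  simp [hτ, hC, hv1, hw1] at this

/-- If the angle of the normal is proportional to the first coordinate and the second coordinate
is a component of the directrix, then the directrix depends on the second coordinate only. -/
lemma directrix_deriv (h : LocalHelix τ ϑ U Y N) (hτ : τ ≠ 0)
    (hN : ∀ x ∈ U, N x 0 = Real.sinh ϑ * Real.cos (rotAngle τ ϑ 0 x) ∧
      N x 1 = Real.sinh ϑ * Real.sin (rotAngle τ ϑ 0 x))
    (hd : (∀ x ∈ U, directrix₁ τ ϑ Y (rotAngle τ ϑ 0) x = x 1) ∨
      (∀ x ∈ U, directrix₂ τ ϑ Y (rotAngle τ ϑ 0) x = x 1)) {x : R2} (hx : x ∈ U) :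
    fderiv ℝ (directrix₁ τ ϑ Y (rotAngle τ ϑ 0)) x e₀ = 0 ∧
    fderiv ℝ (directrix₂ τ ϑ Y (rotAngle τ ϑ 0)) x e₀ = 0 ∧
    (fderiv ℝ (directrix₁ τ ϑ Y (rotAngle τ ϑ 0)) x e₁ = 1 ∨
      fderiv ℝ (directrix₂ τ ϑ Y (rotAngle τ ϑ 0)) x e₁ = 1) := by
  have hC := (Real.cosh_pos ϑ).ne'
  have hY := ContDiffOn.diffAt h.smooth h.isOpen hx
  have hαd := hasFDerivAt_rotAngle τ ϑ 0 x
  have dα0 : fderiv ℝ (rotAngle τ ϑ 0) x e₀ = -2 * τ * Real.cosh ϑ ^ 2 := by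
    rw [hαd.fderiv]; simp
  have dα1 : fderiv ℝ (rotAngle τ ϑ 0) x e₁ = 0 := by
    rw [hαd.fderiv]; simp
  have hn := h.fderiv_normal h.isOpen subset_rfl (contDiff_rotAngle τ ϑ 0).contDiffOn hN hx
  have hst := h.structure_eq hx e₀ e₁
  rw [(hn e₀).1, (hn e₀).2, (hn e₁).1, (hn e₁).2, dα0, dα1] at hst
  have p : ∀ w, _ := fderiv_directrix₁ τ ϑ hY hαd.differentiableAt
  have q : ∀ w, _ := fderiv_directrix₂ τ ϑ hY hαd.differentiableAt
  have p0 : fderiv ℝ (directrix₁ τ ϑ Y (rotAngle τ ϑ 0)) x e₀ =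
      fderiv ℝ Y x e₀ 0 + Real.cosh ϑ * N x 0 := by
    rw [p, dα0, (hN x hx).1, Real.tanh_eq_sinh_div_cosh]; field_simp; ring
  have q0 : fderiv ℝ (directrix₂ τ ϑ Y (rotAngle τ ϑ 0)) x e₀ =
      fderiv ℝ Y x e₀ 1 + Real.cosh ϑ * N x 1 := by
    rw [q, dα0, (hN x hx).2, Real.tanh_eq_sinh_div_cosh]; field_simp; ring
  have p1 : fderiv ℝ (directrix₁ τ ϑ Y (rotAngle τ ϑ 0)) x e₁ = fderiv ℝ Y x e₁ 0 := by
    rw [p, dα1]; ring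
  have q1 : fderiv ℝ (directrix₂ τ ϑ Y (rotAngle τ ϑ 0)) x e₁ = fderiv ℝ Y x e₁ 1 := by
    rw [q, dα1]; ring
  -- This is `dF₁ ∧ dF₂ = 0`. Once one `Fᵢ` is the second coordinate, the other cannot vary with the
  -- first.
  have hcross : fderiv ℝ (directrix₁ τ ϑ Y (rotAngle τ ϑ 0)) x e₀ *
      fderiv ℝ (directrix₂ τ ϑ Y (rotAngle τ ϑ 0)) x e₁ =
      fderiv ℝ (directrix₁ τ ϑ Y (rotAngle τ ϑ 0)) x e₁ *
      fderiv ℝ (directrix₂ τ ϑ Y (rotAngle τ ϑ 0)) x e₀ := by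
    rw [p0, q0, p1, q1]
    have h2 : 2 * τ * Real.cosh ϑ ≠ 0 := by simp [hτ, hC]
    apply mul_left_cancel₀ h2
    linear_combination -hst
  have hcoord : ∀ f : R2 → ℝ, (∀ y ∈ U, f y = y 1) →
      fderiv ℝ f x e₀ = 0 ∧ fderiv ℝ f x e₁ = 1 := by
    intro f hf
    have h1 : HasFDerivAt f (coord 1 : R2 →L[ℝ] ℝ) x :=
      (coord (n := 2) 1).hasFDerivAt.congr_of_eventuallyEq
        (by filter_upwards [h.isOpen.mem_nhds hx] with y hy using hf y hy)
    rw [h1.fderiv]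
    simp
  rcases hd with hd | hd
  · obtain ⟨z0, z1⟩ := hcoord _ hd
    rw [z0, z1, zero_mul, one_mul] at hcross
    exact ⟨z0, hcross.symm, .inl z1⟩
  · obtain ⟨z0, z1⟩ := hcoord _ hd
    rw [z0, z1, mul_zero, mul_one] at hcross
    exact ⟨hcross, z0, .inr z1⟩

end LocalHelix

section

variable {M : Type*} [TopologicalSpace M] [ChartedSpace R2 M] [IsManifold (𝓡 2) ∞ M]

/-- Coordinates given by the angle of the normal and a component of the directrix. -/
lemma IsHelixSpacelike.exists_directrix_chart {τ ϑ : ℝ} (hτ : τ ≠ 0) (hϑ : 0 < ϑ) {X N : M → R3}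
    (hM : IsHelixSpacelike τ ϑ X N) (p : M) :
    ∃ e ∈ IsManifold.maximalAtlas (𝓡 2) ∞ M, p ∈ e.source ∧ Convex ℝ e.target ∧
      (∀ x ∈ e.target, N (e.symm x) 0 = Real.sinh ϑ * Real.cos (rotAngle τ ϑ 0 x) ∧
        N (e.symm x) 1 = Real.sinh ϑ * Real.sin (rotAngle τ ϑ 0 x)) ∧
      ((∀ x ∈ e.target, directrix₁ τ ϑ (fun y => X (e.symm y)) (rotAngle τ ϑ 0) x = x 1) ∨
        (∀ x ∈ e.target, directrix₂ τ ϑ (fun y => X (e.symm y)) (rotAngle τ ϑ 0) x = x 1)) := by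
  have hC := (Real.cosh_pos ϑ).ne'
  have he := IsManifold.chart_mem_maximalAtlas (I := 𝓡 2) (n := ∞) p
  set e := chartAt R2 p
  have hp : p ∈ e.source := mem_chart_source R2 p
  have h := hM.localHelix he
  obtain ⟨V, α, hV, hpV, hVU, hα, hN⟩ := exists_angle e.open_target
    (contDiffOn_coord h.smooth_normal 0) (contDiffOn_coord h.smooth_normal 1)
    (Real.sinh_pos_iff.2 hϑ) h.horizontal (e.map_source hp)
  -- Dividing `α` by this constant gives a first coordinate for which the angle is `rotAngle` with
  -- constant 0.
  have hk : -2 * τ * Real.cosh ϑ ^ 2 ≠ 0 := by simp [hτ, hC]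
  have hαk : ContDiffOn ℝ ∞ (fun x => α x / (-2 * τ * Real.cosh ϑ ^ 2)) V := hα.div_const _
  have hαk0 : ∀ w, fderiv ℝ (fun x => α x / (-2 * τ * Real.cosh ϑ ^ 2)) (e p) w = 0 →
      fderiv ℝ α (e p) w = 0 := by
    intro w hw
    have := ((ContDiffOn.diffAt hα hV hpV).hasFDerivAt.mul_const
      (-2 * τ * Real.cosh ϑ ^ 2)⁻¹).fderiv
    simp only [div_eq_mul_inv] at hw
    rw [this] at hw
    simpa [hτ, hC] using hw
  have key : ∀ d : R2 → ℝ, ContDiffOn ℝ ∞ d V →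
      (∀ w, fderiv ℝ α (e p) w = 0 → fderiv ℝ d (e p) w = 0 → w = 0) →
      ∃ e' ∈ IsManifold.maximalAtlas (𝓡 2) ∞ M, p ∈ e'.source ∧ Convex ℝ e'.target ∧
        ∀ x ∈ e'.target, e (e'.symm x) ∈ V ∧ e'.symm x ∈ e.source ∧
          α (e (e'.symm x)) = rotAngle τ ϑ 0 x ∧ d (e (e'.symm x)) = x 1 := by
    intro d hd hi
    have hs := contDiffOn_pair hαk hd
    obtain ⟨e', he', hpe', hc, hev⟩ := exists_chart_comp he hV hVU hs hpV
      (injective_fderiv_pair (ContDiffOn.diffAt hs hV hpV) fun w h0 h1 => hi w (hαk0 w h0) h1)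
    rw [e.left_inv hp] at hpe'
    refine ⟨e', he', hpe', hc, fun x hx => ?_⟩
    obtain ⟨h1, h2, h3⟩ := hev _ (e'.map_target hx)
    rw [e'.right_inv hx] at h3
    refine ⟨h2, h1, ?_, ?_⟩
    · rw [rotAngle]
      conv_rhs => rw [h3]
      simp
      field_simp
    · conv_rhs => rw [h3]
      simp
  rcases h.exists_independent hτ hV hVU hα hN hpV with hi | hi
  · obtain ⟨e', he', hpe', hc, hev⟩ := key _
      (contDiffOn_directrix₁ τ ϑ (h.smooth.mono hVU) hα) hi
    refine ⟨e', he', hpe', hc, fun x hx => ?_, .inl fun x hx => ?_⟩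
    · obtain ⟨h1, h2, h3, h4⟩ := hev x hx
      have := hN _ h1
      rwa [e.left_inv h2, h3] at this
    · obtain ⟨h1, h2, h3, h4⟩ := hev x hx
      rwa [directrix₁, e.left_inv h2, h3] at h4
  · obtain ⟨e', he', hpe', hc, hev⟩ := key _
      (contDiffOn_directrix₂ τ ϑ (h.smooth.mono hVU) hα) hi
    refine ⟨e', he', hpe', hc, fun x hx => ?_, .inr fun x hx => ?_⟩
    · obtain ⟨h1, h2, h3, h4⟩ := hev x hx
      have := hN _ h1
      rwa [e.left_inv h2, h3] at this
    · obtain ⟨h1, h2, h3, h4⟩ := hev x hx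
      rwa [directrix₂, e.left_inv h2, h3] at h4

end

/-! ### The two halves of the theorem on the surface. -/

section

variable {M : Type*} [TopologicalSpace M] [ChartedSpace R2 M]

/-- Adapted coordinates yield the explicit parametrization. -/
theorem IsAdapted.exists_helixParam {τ ϑ : ℝ} (hτ : τ ≠ 0) (hϑ : 0 < ϑ) {X N : M → R3}
    (hM : IsHelixSpacelike τ ϑ X N) {e : OpenPartialHomeomorph M R2} {η : ℝ → ℝ}
    (he : IsAdapted τ ϑ X N e η) :
    ∃ (c : ℝ) (f₁ f₂ f₃ : ℝ → ℝ),
      ContDiffOn ℝ ∞ f₁ (vRange e) ∧ ContDiffOn ℝ ∞ f₂ (vRange e) ∧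
      ContDiffOn ℝ ∞ f₃ (vRange e) ∧
      (∀ v ∈ vRange e, deriv f₁ v ^ 2 + deriv f₂ v ^ 2 = Real.sinh ϑ ^ 2) ∧
      (∀ v ∈ vRange e, deriv f₃ v = τ * (f₂ v * deriv f₁ v - f₁ v * deriv f₂ v)) ∧
      ∀ x ∈ e.target,
        X (e.symm x) =
          helixParam τ ϑ f₁ f₂ f₃ (-2 * τ * Real.cosh ϑ ^ 2 * x 0 + c) (x 1) := by
  have hC := (Real.cosh_pos ϑ).ne'
  have h := hM.localHelix he.mem_atlas
  have du : ∀ x ∈ e.target, _ := fun x hx => (h.fderiv_eq_iff hx e₀ 1 0).1 (by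
    rw [he.du x hx, hM.tangentPart_eq]; simp)
  have dv : ∀ x ∈ e.target, _ := fun x hx => (h.fderiv_eq_iff hx e₁ _ _).1 (by
    rw [he.dv x hx, hM.tangentPart_eq, hM.rotTangentPart_eq])
  refine h.exists_helixParam hτ hϑ he.convex he.smooth (fun x => rfl) ?_ ?_ ?_ ?_
  · intro x hx
    rw [(du x hx).1]; ring
  · intro x hx
    rw [(du x hx).2]; ring
  · intro x hx
    rw [(dv x hx).1]; field_simp
  · intro x hx
    rw [(dv x hx).2]; field_simp; ring

variable [IsManifold (𝓡 2) ∞ M]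

/-- Reparametrizing the directrix proportionally to arc length gives adapted coordinates. -/
theorem IsHelixSpacelike.exists_isAdapted {τ ϑ : ℝ} (hτ : τ ≠ 0) (hϑ : 0 < ϑ) {X N : M → R3}
    (hM : IsHelixSpacelike τ ϑ X N) (p : M) :
    ∃ (e : OpenPartialHomeomorph M R2) (η : ℝ → ℝ), p ∈ e.source ∧ IsAdapted τ ϑ X N e η := by
  have hC := (Real.cosh_pos ϑ).ne'
  have hS := Real.sinh_pos_iff.2 hϑ
  obtain ⟨e, he, hp, hc, hN, hd⟩ := hM.exists_directrix_chart hτ hϑ p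
  have h := hM.localHelix he
  have hα : ContDiff ℝ ∞ (rotAngle τ ϑ 0) := contDiff_rotAngle τ ϑ 0
  have hdd := fun x hx => h.directrix_deriv hτ hN hd (x := x) hx
  obtain ⟨F₁, S₁, E₁, G₁⟩ := exists_eq_comp_coord_one h.isOpen hc
    (contDiffOn_directrix₁ τ ϑ h.smooth hα.contDiffOn) fun x hx => (hdd x hx).1
  obtain ⟨F₂, S₂, E₂, G₂⟩ := exists_eq_comp_coord_one h.isOpen hc
    (contDiffOn_directrix₂ τ ϑ h.smooth hα.contDiffOn) fun x hx => (hdd x hx).2.1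
  set I : Set ℝ := (fun x : R2 => x 1) '' e.target with hI
  have hIo : IsOpen I := isOpen_image_coord_one h.isOpen
  have hIc : Convex ℝ I := hc.linear_image (coord (n := 2) 1 : R2 →ₗ[ℝ] ℝ)
  have hpos : ∀ v ∈ I, 0 < deriv F₁ v ^ 2 + deriv F₂ v ^ 2 := by
    rintro _ ⟨x, hx, rfl⟩
    simp only [(G₁ x hx).deriv, (G₂ x hx).deriv]
    rcases (hdd x hx).2.2 with h1 | h1 <;> rw [h1] <;> positivity
  have D₁ : ContDiffOn ℝ ∞ (deriv F₁) I :=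
    ((contDiffOn_infty_iff_deriv_of_isOpen hIo).1 S₁).2
  have D₂ : ContDiffOn ℝ ∞ (deriv F₂) I :=
    ((contDiffOn_infty_iff_deriv_of_isOpen hIo).1 S₂).2
  -- A primitive `G` of `g`, taken as new second coordinate, gives the directrix speed `sinh ϑ`.
  let g : ℝ → ℝ := fun v => √(deriv F₁ v ^ 2 + deriv F₂ v ^ 2) / Real.sinh ϑ
  have hg : ContDiffOn ℝ ∞ g I :=
    (((D₁.pow 2).add (D₂.pow 2)).sqrt fun v hv => (hpos v hv).ne').div_const _
  have hg0 : ∀ v ∈ I, 0 < g v := fun v hv => div_pos (Real.sqrt_pos.2 (hpos v hv)) hS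
  have hgS : ∀ v ∈ I, deriv F₁ v ^ 2 + deriv F₂ v ^ 2 = (g v * Real.sinh ϑ) ^ 2 := by
    intro v hv
    rw [div_mul_cancel₀ _ hS.ne', Real.sq_sqrt (hpos v hv).le]
  obtain ⟨G, hG, hGd⟩ := exists_primitive hIo hIc hg
  -- The order and signs come from (*): with `α = -2 τ cosh²ϑ u`, the horizontal part of `∂_v` minus
  -- the multiple of `α_v = 0` must be `-sinh ϑ (sin η, cos η)`.
  obtain ⟨V, β, hV, hpV, hVI, hβ, hβV⟩ := exists_angle hIo
    (D₂.neg.div hg fun v hv => (hg0 v hv).ne') (D₁.neg.div hg fun v hv => (hg0 v hv).ne') hS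
    (fun v hv => by
      have := hgS v hv
      have := (hg0 v hv).ne'
      simp only [Pi.div_apply]
      field_simp
      linarith) (x₀ := e p 1) ⟨e p, e.map_source hp, rfl⟩
  have hF₁ : ∀ v ∈ V, deriv F₁ v = -(g v * (Real.sinh ϑ * Real.sin (β v))) := by
    intro v hv
    have h1 := (hβV v hv).2
    have := (hg0 v (hVI hv)).ne'
    simp only [Pi.div_apply] at h1
    rw [← h1]; field_simp
  have hF₂ : ∀ v ∈ V, deriv F₂ v = -(g v * (Real.sinh ϑ * Real.cos (β v))) := by
    intro v hv
    have h1 := (hβV v hv).1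
    have := (hg0 v (hVI hv)).ne'
    simp only [Pi.div_apply] at h1
    rw [← h1]; field_simp
  let W : Set R2 := e.target ∩ (fun x : R2 => x 1) ⁻¹' V
  have hW : IsOpen W := e.open_target.inter (hV.preimage (coord (n := 2) 1).continuous)
  have hGW : ContDiffOn ℝ ∞ (fun x : R2 => G (x 1)) W :=
    (hG.mono hVI).comp (coord (n := 2) 1).contDiff.contDiffOn fun x hx => hx.2
  have hs := contDiffOn_pair ((coord (n := 2) 0).contDiff.contDiffOn (s := W)) hGW
  have hpW : e p ∈ W := ⟨e.map_source hp, hpV⟩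
  have hinj := injective_fderiv_pair (ContDiffOn.diffAt hs hW hpW) (by
    intro w h0 h1
    have k0 : w 0 = 0 := by
      have c0 : HasFDerivAt (fun y : R2 => y 0) (coord 0 : R2 →L[ℝ] ℝ) (e p) := (coord 0).hasFDerivAt
      rw [← h0]
      exact (congrArg (fun L : R2 →L[ℝ] ℝ => L w) c0.fderiv).symm
    have c1 : HasFDerivAt (fun y : R2 => y 1) (coord 1 : R2 →L[ℝ] ℝ) (e p) := (coord 1).hasFDerivAt
    have k1 := ((hGd _ (hVI hpV)).comp_hasFDerivAt (e p) c1).fderiv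
    have k2 : g (e p 1) * w 1 = 0 := by
      have := congrArg (fun L : R2 →L[ℝ] ℝ => L w) k1
      simp only [Function.comp_def] at this
      rw [h1] at this
      simpa using this.symm
    have k3 : w 1 = 0 := (mul_eq_zero.1 k2).resolve_left (hg0 _ (hVI hpV)).ne'
    rw [R2.eq_smul_add_smul w, k0, k3]; simp)
  obtain ⟨e', he', hpe', hc', hev⟩ := exists_chart_comp he hW inter_subset_left hs hpW hinj
  rw [e.left_inv hp] at hpe'
  have h' := hM.localHelix he'
  have ht : ∀ x ∈ e'.target, e'.symm x ∈ e.source ∧ e (e'.symm x) ∈ W ∧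
      e (e'.symm x) 0 = x 0 ∧ G (e (e'.symm x) 1) = x 1 := by
    intro x hx
    obtain ⟨h1, h2, h3⟩ := hev _ (e'.map_target hx)
    rw [e'.right_inv hx] at h3
    refine ⟨h1, h2, ?_, ?_⟩
    · conv_rhs => rw [h3]
      simp
    · conv_rhs => rw [h3]
      simp
  -- The old second coordinate in the new chart, so that `G ∘ H` is the new one; it replaces a
  -- one-variable inverse of `G`.
  set H : R2 → ℝ := fun x => e (e'.symm x) 1 with hH
  have hHs : ContDiffOn ℝ ∞ H e'.target := by
    refine contDiffOn_coord (contMDiffOn_iff_contDiffOn.1 ?_) 1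
    exact (contMDiffOn_of_mem_maximalAtlas he).comp (contMDiffOn_symm_of_mem_maximalAtlas he')
      fun x hx => (ht x hx).1
  have hHV : ∀ x ∈ e'.target, H x ∈ V := fun x hx => (ht x hx).2.1.2
  have hHd : ∀ x ∈ e'.target, HasFDerivAt H (fderiv ℝ H x) x := fun x hx =>
    (ContDiffOn.diffAt hHs e'.open_target hx).hasFDerivAt
  have hHw : ∀ x ∈ e'.target, ∀ w, g (H x) * fderiv ℝ H x w = w 1 := by
    intro x hx w
    have c1 : HasFDerivAt (fun y : R2 => y 1) (coord 1 : R2 →L[ℝ] ℝ) x := (coord 1).hasFDerivAt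
    have h1 := ((hGd _ (hVI (hHV x hx))).comp_hasFDerivAt x (hHd x hx)).unique
      (c1.congr_of_eventuallyEq
        (by filter_upwards [e'.open_target.mem_nhds hx] with y hy using (ht y hy).2.2.2))
    simpa using congrArg (fun L : R2 →L[ℝ] ℝ => L w) h1
  have hH0 : ∀ x ∈ e'.target, fderiv ℝ H x e₀ = 0 := by
    intro x hx
    have := hHw x hx e₀
    simpa [(hg0 _ (hVI (hHV x hx))).ne'] using this
  -- `η` is the velocity angle `β` expressed in the new second coordinate.
  obtain ⟨η, hη, hηe, -⟩ := exists_eq_comp_coord_one e'.open_target hc'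
    (hβ.comp hHs hHV) fun x hx => by
      have := ((ContDiffOn.diffAt hβ hV (hHV x hx)).hasDerivAt.comp_hasFDerivAt x (hHd x hx)).fderiv
      rw [this]
      simp [hH0 x hx]
  have hrot : ∀ x ∈ e'.target, rotAngle τ ϑ 0 (e (e'.symm x)) = rotAngle τ ϑ 0 x := by
    intro x hx
    rw [rotAngle, rotAngle, (ht x hx).2.2.1]
  have hN' : ∀ x ∈ e'.target, N (e'.symm x) 0 = Real.sinh ϑ * Real.cos (rotAngle τ ϑ 0 x) ∧
      N (e'.symm x) 1 = Real.sinh ϑ * Real.sin (rotAngle τ ϑ 0 x) := by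
    intro x hx
    have := hN _ (ht x hx).2.1.1
    rwa [e.left_inv (ht x hx).1, hrot x hx] at this
  have hD : ∀ F : ℝ → ℝ, ContDiffOn ℝ ∞ F I → ∀ d : R2 → ℝ, (∀ x ∈ e'.target, d x = F (H x)) →
      ∀ x ∈ e'.target, ∀ w, fderiv ℝ d x w = deriv F (H x) * fderiv ℝ H x w := by
    intro F hF d hdF x hx w
    have h1 := ((ContDiffOn.diffAt hF hIo (hVI (hHV x hx))).hasDerivAt.comp_hasFDerivAt x
      (hHd x hx)).congr_of_eventuallyEq
      (by filter_upwards [e'.open_target.mem_nhds hx] with y hy using hdF y hy)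
    rw [h1.fderiv]
    simp
  have hd₁ := hD F₁ S₁ (directrix₁ τ ϑ (fun y => X (e'.symm y)) (rotAngle τ ϑ 0)) fun x hx => by
    rw [← E₁ _ (ht x hx).2.1.1, directrix₁, directrix₁, e.left_inv (ht x hx).1, hrot x hx]
  have hd₂ := hD F₂ S₂ (directrix₂ τ ϑ (fun y => X (e'.symm y)) (rotAngle τ ϑ 0)) fun x hx => by
    rw [← E₂ _ (ht x hx).2.1.1, directrix₂, directrix₂, e.left_inv (ht x hx).1, hrot x hx]
  have hY : ∀ x ∈ e'.target, DifferentiableAt ℝ (fun y => X (e'.symm y)) x := fun x hx =>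
    ContDiffOn.diffAt h'.smooth h'.isOpen hx
  have hαd := hasFDerivAt_rotAngle τ ϑ 0
  have dα0 : ∀ x, fderiv ℝ (rotAngle τ ϑ 0) x e₀ = -2 * τ * Real.cosh ϑ ^ 2 := fun x => by
    rw [(hαd x).fderiv]; simp
  have dα1 : ∀ x, fderiv ℝ (rotAngle τ ϑ 0) x e₁ = 0 := fun x => by
    rw [(hαd x).fderiv]; simp
  refine ⟨e', η, hpe', he', hc', hη, fun x hx => ?_, fun x hx => ?_⟩
  · have q₁ := hd₁ x hx e₀
    have q₂ := hd₂ x hx e₀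
    rw [fderiv_directrix₁ τ ϑ (hY x hx) (hαd x).differentiableAt, hH0 x hx, dα0] at q₁
    rw [fderiv_directrix₂ τ ϑ (hY x hx) (hαd x).differentiableAt, hH0 x hx, dα0] at q₂
    rw [Real.tanh_eq_sinh_div_cosh] at q₁ q₂
    have := (h'.fderiv_eq_iff hx e₀ 1 0).2 ⟨by
      rw [(hN' x hx).1, sub_eq_iff_eq_add.1 q₁]; field_simp; ring, by
      rw [(hN' x hx).2, sub_eq_iff_eq_add.1 q₂]; field_simp; ring⟩
    rw [this, hM.tangentPart_eq]
    simp
  · have q₁ := hd₁ x hx e₁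
    have q₂ := hd₂ x hx e₁
    have q₃ := hHw x hx e₁
    rw [fderiv_directrix₁ τ ϑ (hY x hx) (hαd x).differentiableAt, dα1, hF₁ _ (hHV x hx)] at q₁
    rw [fderiv_directrix₂ τ ϑ (hY x hx) (hαd x).differentiableAt, dα1, hF₂ _ (hHV x hx)] at q₂
    have hβη : β (H x) = η (x 1) := hηe x hx
    rw [hβη] at q₁ q₂
    have hone : (e₁ : R2) 1 = 1 := by simp
    rw [hone] at q₃
    -- Writing `η` as `θ` minus the normal angle lets the addition formulas split the directrix
    -- velocity along `T` and `JT`.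
    have hsplit : η (x 1) = (η (x 1) - 2 * τ * Real.cosh ϑ ^ 2 * x 0) - rotAngle τ ϑ 0 x := by
      rw [rotAngle]; ring
    rw [hM.tangentPart_eq, hM.rotTangentPart_eq]
    refine (h'.fderiv_eq_iff hx e₁ _ _).2 ?_
    rw [(hN' x hx).1, (hN' x hx).2]
    rw [hsplit] at q₁ q₂
    set θ := η (x 1) - 2 * τ * Real.cosh ϑ ^ 2 * x 0
    rw [Real.sin_sub] at q₁
    rw [Real.cos_sub] at q₂
    constructor
    · field_simp
      linear_combination q₁ - Real.sinh ϑ * (Real.sin θ * Real.cos (rotAngle τ ϑ 0 x)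
        - Real.cos θ * Real.sin (rotAngle τ ϑ 0 x)) * q₃
    · field_simp
      linear_combination q₂ - Real.sinh ϑ * (Real.cos θ * Real.cos (rotAngle τ ϑ 0 x)
        + Real.sin θ * Real.sin (rotAngle τ ϑ 0 x)) * q₃

end

end LorentzHeisenberg

theorem theorem1 {M : Type*} [TopologicalSpace M] [ChartedSpace R2 M] [IsManifold (𝓡 2) ∞ M]
    (τ ϑ : ℝ) (hτ : τ ≠ 0) (hϑ : 0 < ϑ) (X N : M → R3) (hM : IsHelixSpacelike τ ϑ X N) :
    (∀ p : M, ∃ (e : OpenPartialHomeomorph M R2) (η : ℝ → ℝ),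
      p ∈ e.source ∧ IsAdapted τ ϑ X N e η) ∧
    (∀ (e : OpenPartialHomeomorph M R2) (η : ℝ → ℝ), IsAdapted τ ϑ X N e η →
      ∃ (c : ℝ) (f₁ f₂ f₃ : ℝ → ℝ),
        ContDiffOn ℝ ∞ f₁ (vRange e) ∧ ContDiffOn ℝ ∞ f₂ (vRange e) ∧
        ContDiffOn ℝ ∞ f₃ (vRange e) ∧
        (∀ v ∈ vRange e, deriv f₁ v ^ 2 + deriv f₂ v ^ 2 = Real.sinh ϑ ^ 2) ∧
        (∀ v ∈ vRange e, deriv f₃ v = τ * (f₂ v * deriv f₁ v - f₁ v * deriv f₂ v)) ∧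
        ∀ x ∈ e.target,
          X (e.symm x) =
            helixParam τ ϑ f₁ f₂ f₃ (-2 * τ * Real.cosh ϑ ^ 2 * x 0 + c) (x 1)) :=
  ⟨fun p => hM.exists_isAdapted hτ hϑ p, fun _ _ he => he.exists_helixParam hτ hϑ hM⟩
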